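/- Let $0<\alpha<1$ and let $\underline E=(E_i)_{i\in\mathbb N}$ be independent exponential random variables of parameter $\alpha$ (the energy landscape). Given $\underline E$ and $N\ge 1$, let $Y_N=(Y_N(t))_{t\ge 0}$ be the continuous-time random walk (with right-continuous paths) on the complete graph on $\{1,\dots,N\}$ which jumps from $i$ to $j\neq i$ at rate $e^{-E_i}/N$ and is started from the uniform distribution; let $\mathbb P_N$ be its law given $\underline E$, and let $$\Pi_N(t,t_w):=\mathbb P_N\bigl(Y_N(s)=Y_N(t_w)\ \text{ for all } s\in[t_w,t_w+t]\bigr),\qquad t,t_w\ge 0 .$$ Then for almost every realisation of $\underline E$ the following holds for every $\theta>0$: the limit $\lim_{N\to\infty}\Pi_N(\theta t_w,t_w)$ exists for every $t_w\ge 0$, and $$\lim_{t_w\to\infty}\ \lim_{N\to\infty}\Pi_N(\theta t_w,t_w)=\frac{\sin(\pi\alpha)}{\pi}\int_{\theta/(1+\theta)}^1 u^{-\alpha}(1-u)^{\alpha-1}\,du .$$ -/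

import Mathlib

open Filter Topology MeasureTheory ProbabilityTheory
open scoped NNReal

namespace TrapModel

/-- The infinitesimal generator (Q-matrix) of a continuous-time random walk on a finite set with
jump rates `c i j` (`i ≠ j`): the off-diagonal entries are the rates, and the rows sum to `0`.
The diagonal values `c i i` play no role. -/
noncomputable def generator {S : Type*} [Fintype S] [DecidableEq S] (c : S → S → ℝ) :
    Matrix S S ℝ :=
  fun i j => if i = j then -∑ k ∈ Finset.univ.erase i, c i k else c i j

/-- `Y` is, under `P`, the continuous-time random walk on the finite set `S` with jump rates
`c i j` and initial distribution `ν`: a process with right-continuous paths (for the discrete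
topology on `S`, so that paths are right-continuous step functions) which starts from `ν` and has
the Markov property with transition probabilities `p_t(i, j) = (exp (t Q)) i j`, where `Q` is the
generator. The field `markov` is the elementary Markov property, with the conditional probability
multiplied out. -/
structure IsRandomWalk {S : Type*} [Fintype S] [DecidableEq S] (c : S → S → ℝ) (ν : S → ℝ)
    {Ω : Type*} [MeasurableSpace Ω] (P : Measure Ω) (Y : ℝ≥0 → Ω → S) : Prop where
  isProbabilityMeasure : IsProbabilityMeasure P
  measurableSet_eq : ∀ (t : ℝ≥0) (i : S), MeasurableSet {ω | Y t ω = i}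
  right_continuous : ∀ (ω : Ω) (t : ℝ≥0), ∀ᶠ s in 𝓝[≥] t, Y s ω = Y t ω
  initial : ∀ i : S, P.real {ω | Y 0 ω = i} = ν i
  markov : ∀ (n : ℕ) (t : ℕ → ℝ≥0) (i : ℕ → S), Monotone t →
    P.real {ω | ∀ k ≤ n + 1, Y (t k) ω = i k} =
      P.real {ω | ∀ k ≤ n, Y (t k) ω = i k} *
        NormedSpace.exp (((t (n + 1) : ℝ) - (t n : ℝ)) • generator c) (i n) (i (n + 1))

/-- The walk `Y_N` of the REM-like trap model with `N` sites in the energy landscape `E`: the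
random walk on the complete graph with `N` vertices with rates `c i j = exp (-E i) / N`
for `i ≠ j`, started from the uniform distribution. The sites are `0, …, N - 1`. -/
def IsTrapWalk (N : ℕ) (E : ℕ → ℝ) {Ω : Type*} [MeasurableSpace Ω] (P : Measure Ω)
    (Y : ℝ≥0 → Ω → Fin N) : Prop :=
  IsRandomWalk (fun i _ : Fin N => Real.exp (-E i) / N) (fun _ => 1 / (N : ℝ)) P Y

/-- The time-time correlation function
`Π(t, t_w) = P (Y s = Y t_w for all s ∈ [t_w, t_w + t])`. -/
noncomputable def correlation {S : Type*} {Ω : Type*} [MeasurableSpace Ω] (P : Measure Ω)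
    (Y : ℝ≥0 → Ω → S) (t tw : ℝ≥0) : ℝ :=
  P.real {ω | ∀ s ∈ Set.Icc tw (tw + t), Y s ω = Y tw ω}

end TrapModel

/-!
Write `x i = exp (-E i)`. On `n` sites the walk waits at `i` an exponential time of parameter `x i`
and then chooses a new site uniformly, possibly `i` itself. Let `m t j` be the law of the walk
(`trapLaw`), `a t = ∑ j, x j * m t j` the rate at which new sites are chosen (`renewalRate`) and `G`
the Laplace transform of the empirical distribution of the rates (`empiricalTail`). Variation of
constants gives, for all `τ` (`sum_trapLaw_mul_exp`),
`∑ j, m t j * exp (-x j τ) = G (t + τ) + ∫ s in 0..t, G (t + τ - s) * a s`.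
The left side is the correlation function when `τ` is the length of the time window times
`1 - 1 / n` (`correlation_eq_sum`, from right-continuity and the Markov property along dyadic
subdivisions), and it is `1` when `τ = 0`: this is the renewal equation.

As `n → ∞`, only the moments of the empirical distribution of the rates matter: `G t` and `a t` are
power series in `t` whose coefficients are functions of these moments (for `a`, the coefficients are
the averages of `Q ^ k x`, `Q` the generator), so they converge for every `t` as soon as the moments
do. By the law of large numbers the moments converge almost surely, to those of the law
`α y ^ (α - 1) dy` on `(0, 1)`. The limits, again called `a` and `G` (`trapTail`), satisfy the same
equations, so what is left is the Dynkin-Lamperti theorem for the renewal measure `U = δ₀ + a(s) ds`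
(`tendsto_no_renewal`).

No Tauberian theorem is needed for it. One has `G t ~ Γ(α + 1) t ^ (-α)`, so the convolution of `G`
with the kernel `x ^ (α - 1)`, which is inverse to `t ^ (-α)` up to a constant, increases to a
constant `K` (`tendsto_betaConv`). Convolving the renewal equation `G ⋆ U = 1` with the kernel yields
`∫ betaConv α (t - s) U(ds) = t ^ α / α` (`betaConv_add_integral`), and replacing `betaConv` by `K`
costs little because `a ≤ 1`; hence `U [0, t] ~ t ^ α / (α K)` (`tendsto_renewalFunction`). The
correlation is asymptotic to `Γ(α + 1) ∫ ((1 + θ) t - s) ^ (-α) U(ds)` over `[0, t]`, and an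
integration by parts turns the asymptotics of `U [0, t]` into the limit of this integral.
-/

namespace TrapModel

/-! ### Matrix exponential and random walks on a finite set -/

section MatrixExponential

variable {S : Type*} [Fintype S] [DecidableEq S]

open scoped Matrix.Norms.Operator in
lemma hasDerivAt_exp_smul_apply (Q : Matrix S S ℝ) (t : ℝ) (i j : S) :
    HasDerivAt (fun u : ℝ => NormedSpace.exp (u • Q) i j)
      ((NormedSpace.exp (t • Q) * Q) i j) t := by
  have h := hasDerivAt_exp_smul_const (𝕂 := ℝ) Q t
  exact (LinearMap.toContinuousLinearMap (Matrix.entryLinearMap ℝ ℝ i j)).hasFDerivAt.comp_hasDerivAt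
    t h

open scoped Matrix.Norms.Operator in
lemma hasSum_exp_smul_apply (Q : Matrix S S ℝ) (t : ℝ) (i j : S) :
    HasSum (fun k : ℕ => t ^ k / (k.factorial : ℝ) * (Q ^ k) i j)
      (NormedSpace.exp (t • Q) i j) := by
  have h := NormedSpace.exp_series_hasSum_exp' (𝕂 := ℝ) (t • Q)
  have h2 := h.mapL (LinearMap.toContinuousLinearMap (Matrix.entryLinearMap ℝ ℝ i j))
  convert! h2 using 2 with k
  simp [smul_pow, div_eq_inv_mul, mul_assoc]

/-- Every diagonal entry of `exp (t Q)` behaves for small times like `exp (t Q i i)`; multiplying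
over a fine partition of `[0, t]` gives the survival probability at `i`. -/
lemma tendsto_exp_smul_apply_self_pow (Q : Matrix S S ℝ) (t : ℝ) (i : S) :
    Tendsto (fun n : ℕ => (NormedSpace.exp ((t / n) • Q) i i) ^ n) atTop
      (𝓝 (Real.exp (t * Q i i))) := by
  have hd : HasDerivAt (fun u : ℝ => NormedSpace.exp ((u * t) • Q) i i) (t * Q i i) 0 := by
    have h := hasDerivAt_exp_smul_apply Q (0 * t) i i
    have h1 := h.comp 0 ((hasDerivAt_id (0 : ℝ)).mul_const t)
    simpa [Function.comp_def, mul_comm] using h1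
  have hs := hd.tendsto_slope_zero_right
  have hn : Tendsto (fun n : ℕ => ((n : ℝ))⁻¹) atTop (𝓝[>] 0) :=
    tendsto_inv_atTop_nhdsGT_zero.comp tendsto_natCast_atTop_atTop
  have h1 := hs.comp hn
  have h2 := Real.tendsto_one_add_pow_exp_of_tendsto
    (g := fun n : ℕ => NormedSpace.exp ((t / n) • Q) i i - 1) (t := t * Q i i) (by
      refine h1.congr fun n => ?_
      simp [div_eq_inv_mul])
  exact h2.congr fun n => by simp

end MatrixExponential

section RandomWalk

variable {S : Type*} [Fintype S] [DecidableEq S] {c : S → S → ℝ} {ν : S → ℝ}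
  {Ω : Type*} [MeasurableSpace Ω] {P : Measure Ω} {Y : ℝ≥0 → Ω → S}

lemma measureReal_eq_sum_fiber (hY : IsRandomWalk c ν P Y) (s : ℝ≥0) {A : Set Ω}
    (hA : MeasurableSet A) : P.real A = ∑ i, P.real ({ω | Y s ω = i} ∩ A) := by
  have := hY.isProbabilityMeasure
  rw [← measureReal_biUnion_finset]
  · congr 1; ext ω; simp
  · intro i _ j _ hij
    refine Set.disjoint_left.2 fun ω h1 h2 => hij ?_
    exact h1.1.symm.trans h2.1
  · exact fun i _ => (hY.measurableSet_eq s i).inter hA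

/-- The one-dimensional marginals of the walk are `ν exp (t Q)`. -/
lemma measureReal_marginal (hY : IsRandomWalk c ν P Y) (t : ℝ≥0) (j : S) :
    P.real {ω | Y t ω = j} =
      ∑ i, ν i * NormedSpace.exp ((t : ℝ) • generator c) i j := by
  rw [measureReal_eq_sum_fiber hY 0 (hY.measurableSet_eq t j)]
  refine Finset.sum_congr rfl fun i _ => ?_
  have h := hY.markov 0 (fun k => if k = 0 then 0 else t) (fun k => if k = 0 then i else j)
    (by
      refine monotone_nat_of_le_succ fun n => ?_
      by_cases hn : n = 0 <;> simp [hn])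
  have e1 : {ω | ∀ k ≤ 0 + 1, Y (if k = 0 then 0 else t) ω = if k = 0 then i else j}
      = {ω | Y 0 ω = i} ∩ {ω | Y t ω = j} := by
    ext ω
    simp only [Set.mem_ofPred_eq, Set.mem_inter_iff]
    constructor
    · intro h; exact ⟨by simpa using h 0 (by simp), by simpa using h 1 (by simp)⟩
    · rintro ⟨h0, h1⟩ k hk
      interval_cases k <;> simpa
  have e2 : {ω | ∀ k ≤ 0, Y (if k = 0 then 0 else t) ω = if k = 0 then i else j}
      = {ω | Y 0 ω = i} := by
    ext ω; simp
  rw [e1, e2, hY.initial] at h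
  simpa using h

lemma measureReal_grid (hY : IsRandomWalk c ν P Y) (s h : ℝ≥0) (i : S) (n : ℕ) :
    P.real {ω | ∀ k ≤ n, Y (s + k * h) ω = i} =
      P.real {ω | Y s ω = i} * (NormedSpace.exp ((h : ℝ) • generator c) i i) ^ n := by
  induction n with
  | zero => simp
  | succ n ih =>
    have hm := hY.markov n (fun k => s + k * h) (fun _ => i) (by
      intro a b hab
      have : (a : ℝ≥0) ≤ b := by exact_mod_cast hab
      dsimp only
      gcongr)
    rw [hm, ih, pow_succ, mul_assoc]
    congr 4
    push_cast
    ring_nf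

/-- By right-continuity, it suffices to look at the walk along the dyadic subdivisions of
`[s, s + t]`. -/
lemma stay_eq_iInter_grid (hY : IsRandomWalk c ν P Y) (t s : ℝ≥0) (i : S) :
    {ω | Y s ω = i} ∩ {ω | ∀ r ∈ Set.Icc s (s + t), Y r ω = Y s ω} =
      ⋂ m : ℕ, {ω | ∀ k : ℕ, k ≤ 2 ^ m → Y (s + k * (t / 2 ^ m)) ω = i} := by
  ext ω
  simp only [Set.mem_inter_iff, Set.mem_ofPred_eq, Set.mem_iInter]
  constructor
  · rintro ⟨h0, h⟩ m k hk
    rw [h _ ⟨by simp, ?_⟩, h0]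
    gcongr
    have : (k : ℝ≥0) ≤ 2 ^ m := by exact_mod_cast hk
    calc (k : ℝ≥0) * (t / 2 ^ m) ≤ 2 ^ m * (t / 2 ^ m) := by gcongr
      _ = t := by field_simp
  · intro h
    have h0 : Y s ω = i := by simpa using h 0 0 (by simp)
    refine ⟨h0, fun r hr => ?_⟩
    rw [h0]
    rcases eq_or_lt_of_le (zero_le : 0 ≤ t) with ht | ht
    · obtain rfl : r = s := le_antisymm (by simpa only [← ht, add_zero] using hr.2) hr.1
      exact h0
    -- the dyadic times just after `r`
    have ht' : (0 : ℝ) < t := ht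
    have hr1 : (s : ℝ) ≤ r := hr.1
    have hr2 : (r : ℝ) ≤ s + t := by exact_mod_cast hr.2
    set x : ℝ := ((r : ℝ) - s) / t with hx
    have hx0 : 0 ≤ x := div_nonneg (by linarith) ht'.le
    have hx1 : x ≤ 1 := by rw [hx, div_le_one ht']; linarith
    have hxt : (r : ℝ) = s + x * t := by rw [hx]; field_simp; ring
    let k : ℕ → ℕ := fun m => ⌈x * 2 ^ m⌉₊
    have hk : ∀ m, k m ≤ 2 ^ m := fun m => Nat.ceil_le.2 (by
      push_cast
      exact mul_le_of_le_one_left (by positivity) hx1)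
    have hlo : ∀ m, r ≤ s + k m * (t / 2 ^ m) := fun m => by
      have h1 : x * 2 ^ m ≤ k m := Nat.le_ceil _
      rw [← NNReal.coe_le_coe]
      push_cast
      rw [hxt, show x * (t : ℝ) = x * 2 ^ m * (t / 2 ^ m) by field_simp]
      gcongr
    have hlim : Tendsto (fun m => s + k m * (t / 2 ^ m)) atTop (𝓝 r) := by
      rw [← NNReal.tendsto_coe]
      have hup : Tendsto (fun m : ℕ => (r : ℝ) + t * (1 / 2) ^ m) atTop (𝓝 r) := by
        simpa using ((tendsto_pow_atTop_nhds_zero_of_lt_one (r := (1 / 2 : ℝ)) (by norm_num)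
          (by norm_num)).const_mul (t : ℝ)).const_add (r : ℝ)
      refine tendsto_of_tendsto_of_tendsto_of_le_of_le tendsto_const_nhds hup
        (fun m => NNReal.coe_le_coe.2 (hlo m)) fun m => ?_
      have h1 : (k m : ℝ) ≤ x * 2 ^ m + 1 := (Nat.ceil_lt_add_one (by positivity)).le
      push_cast
      calc (s : ℝ) + k m * (t / 2 ^ m) ≤ s + (x * 2 ^ m + 1) * (t / 2 ^ m) := by gcongr
        _ = r + t * (1 / 2) ^ m := by rw [hxt, one_div, inv_pow]; field_simp; ring
    have hw : Tendsto (fun m => s + k m * (t / 2 ^ m)) atTop (𝓝[≥] r) :=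
      tendsto_nhdsWithin_iff.2 ⟨hlim, Eventually.of_forall hlo⟩
    obtain ⟨m, hm⟩ := (hw.eventually (hY.right_continuous ω r)).exists
    rw [← hm, h m _ (hk m)]

lemma measurableSet_grid (hY : IsRandomWalk c ν P Y) (s h : ℝ≥0) (i : S) (n : ℕ) :
    MeasurableSet {ω | ∀ k ≤ n, Y (s + k * h) ω = i} := by
  have : {ω | ∀ k ≤ n, Y (s + k * h) ω = i} = ⋂ k ∈ Set.Iic n, {ω | Y (s + k * h) ω = i} := by
    ext ω; simp
  rw [this]
  exact MeasurableSet.biInter (Set.to_countable _) fun k _ => hY.measurableSet_eq _ _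

/-- The walk that sits at `i` stays there for an exponential time of parameter `-Q i i`. -/
lemma measureReal_stay (hY : IsRandomWalk c ν P Y) (t s : ℝ≥0) (i : S) :
    P.real ({ω | Y s ω = i} ∩ {ω | ∀ r ∈ Set.Icc s (s + t), Y r ω = Y s ω}) =
      P.real {ω | Y s ω = i} * Real.exp (t * generator c i i) := by
  have := hY.isProbabilityMeasure
  rw [stay_eq_iInter_grid hY]
  have hanti : Antitone fun m : ℕ => {ω | ∀ k : ℕ, k ≤ 2 ^ m → Y (s + k * (t / 2 ^ m)) ω = i} := by
    refine antitone_nat_of_succ_le fun m ω hω k hk => ?_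
    have h := hω (2 * k) (by rw [pow_succ]; omega)
    rwa [show ((2 * k : ℕ) : ℝ≥0) * (t / 2 ^ (m + 1)) = k * (t / 2 ^ m) by
      push_cast; rw [pow_succ]; field_simp] at h
  have h1 := tendsto_measure_iInter_atTop (μ := P)
    (fun m => (measurableSet_grid hY s (t / 2 ^ m) i (2 ^ m)).nullMeasurableSet) hanti
    ⟨0, measure_ne_top _ _⟩
  have h2 := (ENNReal.tendsto_toReal (measure_ne_top _ _)).comp h1
  have h3 := ((tendsto_exp_smul_apply_self_pow (generator c) t i).comp
    (tendsto_pow_atTop_atTop_of_one_lt (r := (2 : ℕ)) (by norm_num))).const_mul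
    (P.real {ω | Y s ω = i})
  refine tendsto_nhds_unique h2 (h3.congr fun m => ?_)
  have h4 := measureReal_grid hY s (t / 2 ^ m) i (2 ^ m)
  simp only [Function.comp_apply]
  rw [← Measure.real, h4]
  push_cast
  rfl

lemma measurableSet_stay (hY : IsRandomWalk c ν P Y) (t s : ℝ≥0) :
    MeasurableSet {ω | ∀ r ∈ Set.Icc s (s + t), Y r ω = Y s ω} := by
  have : {ω | ∀ r ∈ Set.Icc s (s + t), Y r ω = Y s ω} =
      ⋃ i, {ω | Y s ω = i} ∩ {ω | ∀ r ∈ Set.Icc s (s + t), Y r ω = Y s ω} := by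
    ext ω; simp
  rw [this]
  refine MeasurableSet.iUnion fun i => ?_
  rw [stay_eq_iInter_grid hY]
  exact MeasurableSet.iInter fun m => measurableSet_grid hY _ _ _ _

theorem correlation_eq_sum (hY : IsRandomWalk c ν P Y) (t s : ℝ≥0) :
    correlation P Y t s =
      ∑ i, P.real {ω | Y s ω = i} * Real.exp (t * generator c i i) := by
  rw [correlation, measureReal_eq_sum_fiber hY s (measurableSet_stay hY t s)]
  · exact Finset.sum_congr rfl fun i _ => measureReal_stay hY t s i

end RandomWalk

/-! ### The trap walk on finitely many sites -/

section FiniteVolume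

variable {n : ℕ}

/-- The generator of the trap walk on `n` sites with rates `x i / n` out of site `i`. -/
noncomputable def trapGenerator (x : Fin n → ℝ) : Matrix (Fin n) (Fin n) ℝ :=
  generator fun i _ => x i / n

/-- The trap walk jumps away from `i` at rate `x i` to a uniformly chosen site, possibly `i`
itself. -/
lemma trapGenerator_apply (x : Fin n → ℝ) (i j : Fin n) :
    trapGenerator x i j = x i / n - if i = j then x i else 0 := by
  have hn : (n : ℝ) ≠ 0 := by
    have := i.pos
    positivity
  unfold trapGenerator generator
  split_ifs with h
  · rw [Finset.sum_const, Finset.card_erase_of_mem (Finset.mem_univ _), Finset.card_univ,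
      Fintype.card_fin, nsmul_eq_mul, Nat.cast_sub i.pos]
    field_simp
    push_cast
    ring
  · simp

lemma trapGenerator_mulVec (x v : Fin n → ℝ) (i : Fin n) :
    (trapGenerator x).mulVec v i = x i * ((∑ j, v j) / n) - x i * v i := by
  simp only [Matrix.mulVec, dotProduct, trapGenerator_apply, sub_mul, Finset.sum_sub_distrib,
    ite_mul, zero_mul, Finset.sum_ite_eq, Finset.mem_univ, if_true, ← Finset.mul_sum]
  ring

lemma mul_trapGenerator (x : Fin n → ℝ) (M : Matrix (Fin n) (Fin n) ℝ) (i j : Fin n) :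
    (M * trapGenerator x) i j = (∑ k, M i k * x k) / n - M i j * x j := by
  simp only [Matrix.mul_apply, trapGenerator_apply, mul_sub, Finset.sum_sub_distrib,
    mul_ite, mul_zero, Finset.sum_ite_eq', Finset.mem_univ, if_true, Finset.sum_div, mul_div_assoc]

/-- The law at time `t` of the trap walk started from the uniform distribution. -/
noncomputable def trapLaw (x : Fin n → ℝ) (t : ℝ) (j : Fin n) : ℝ :=
  ∑ i, 1 / (n : ℝ) * NormedSpace.exp (t • trapGenerator x) i j

/-- The rate at which the trap walk chooses a new site at time `t`; it is the density of the
renewal measure of the walk. -/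
noncomputable def renewalRate (x : Fin n → ℝ) (t : ℝ) : ℝ :=
  ∑ j, trapLaw x t j * x j

/-- The Laplace transform of the empirical distribution of the rates, that is, the tail of the
waiting time at a uniformly chosen site. -/
noncomputable def empiricalTail (x : Fin n → ℝ) (t : ℝ) : ℝ :=
  (∑ j, Real.exp (-(x j * t))) / n

lemma trapLaw_zero (x : Fin n → ℝ) (j : Fin n) : trapLaw x 0 j = 1 / n := by
  simp [trapLaw, Matrix.one_apply]

lemma hasDerivAt_trapLaw (x : Fin n → ℝ) (t : ℝ) (j : Fin n) :
    HasDerivAt (fun u => trapLaw x u j) (renewalRate x t / n - x j * trapLaw x t j) t := by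
  have h := HasDerivAt.fun_sum (u := Finset.univ) fun (i : Fin n) _ =>
    (hasDerivAt_exp_smul_apply (trapGenerator x) t i j).const_mul (1 / (n : ℝ))
  refine h.congr_deriv ?_
  simp only [mul_trapGenerator, mul_sub, Finset.sum_sub_distrib, renewalRate, trapLaw]
  congr 1
  · simp only [Finset.sum_mul, Finset.sum_div, Finset.mul_sum]
    rw [Finset.sum_comm]
    refine Finset.sum_congr rfl fun _ _ => Finset.sum_congr rfl fun _ _ => by ring
  · rw [Finset.mul_sum]
    exact Finset.sum_congr rfl fun _ _ => by ring

lemma continuous_trapLaw (x : Fin n → ℝ) (j : Fin n) : Continuous fun t => trapLaw x t j :=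
  continuous_iff_continuousAt.2 fun t => (hasDerivAt_trapLaw x t j).continuousAt

lemma continuous_renewalRate (x : Fin n → ℝ) : Continuous (renewalRate x) :=
  continuous_finsetSum _ fun j _ => (continuous_trapLaw x j).mul_const _

lemma continuous_empiricalTail (x : Fin n → ℝ) : Continuous (empiricalTail x) := by
  unfold empiricalTail
  fun_prop

/-- Decomposition over the last time before `t` at which a new site is chosen. -/
theorem sum_trapLaw_mul_exp (x : Fin n → ℝ) (t τ : ℝ) :
    ∑ j, trapLaw x t j * Real.exp (-(x j * τ)) =
      empiricalTail x (t + τ) + ∫ s in 0..t, empiricalTail x (t + τ - s) * renewalRate x s := by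
  have key : ∀ j, trapLaw x t j * Real.exp (-(x j * τ)) =
      Real.exp (-(x j * (t + τ))) / n +
        ∫ s in 0..t, Real.exp (-(x j * (t + τ - s))) / n * renewalRate x s := by
    intro j
    have hd : ∀ s ∈ Set.uIcc 0 t, HasDerivAt
        (fun s => trapLaw x s j * Real.exp (-(x j * (t + τ - s))))
        (Real.exp (-(x j * (t + τ - s))) / n * renewalRate x s) s := by
      intro s _
      have h1 : HasDerivAt (fun s => Real.exp (-(x j * (t + τ - s))))
          (Real.exp (-(x j * (t + τ - s))) * x j) s := by
        have h2 : HasDerivAt (fun s => -(x j * (t + τ - s))) (x j) s := by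
          simpa using (((hasDerivAt_id s).const_sub (t + τ)).const_mul (x j)).fun_neg
        exact h2.exp
      refine ((hasDerivAt_trapLaw x s j).mul h1).congr_deriv ?_
      ring
    have hc := continuous_renewalRate x
    rw [intervalIntegral.integral_eq_sub_of_hasDerivAt hd
      (Continuous.intervalIntegrable (by fun_prop) _ _), trapLaw_zero]
    simp only [add_sub_cancel_left, sub_zero]
    ring
  have hc := continuous_renewalRate x
  simp only [key, Finset.sum_add_distrib, empiricalTail, Finset.sum_div, Finset.sum_mul]
  rw [intervalIntegral.integral_finsetSum]
  exact fun j _ => Continuous.intervalIntegrable (by fun_prop) _ _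

lemma renewalRate_hasSum (x : Fin n → ℝ) (t : ℝ) :
    HasSum (fun k : ℕ => t ^ k / (k.factorial : ℝ) *
      ((∑ i, ((trapGenerator x) ^ k).mulVec x i) / n)) (renewalRate x t) := by
  have h := hasSum_sum (s := Finset.univ) fun (j : Fin n) _ =>
    (hasSum_sum (s := Finset.univ) fun (i : Fin n) _ =>
      (hasSum_exp_smul_apply (trapGenerator x) t i j).mul_left (1 / (n : ℝ))).mul_right (x j)
  convert! h using 2 with k
  simp only [Matrix.mulVec, dotProduct, Finset.sum_mul, Finset.sum_div, Finset.mul_sum]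
  rw [Finset.sum_comm]
  exact Finset.sum_congr rfl fun _ _ => Finset.sum_congr rfl fun _ _ => by ring

/-- Bound on the powers of the generator in the supremum norm. -/
lemma abs_trapGenerator_pow_mulVec_le {x : Fin n → ℝ} (h0 : ∀ i, 0 ≤ x i) (h1 : ∀ i, x i ≤ 1)
    (k : ℕ) (i : Fin n) : |((trapGenerator x) ^ k).mulVec x i| ≤ 2 ^ k := by
  induction k generalizing i with
  | zero => simpa [abs_of_nonneg (h0 i)] using h1 i
  | succ k ih =>
    have hn : (0 : ℝ) < n := by exact_mod_cast i.pos
    rw [pow_succ', ← Matrix.mulVec_mulVec, trapGenerator_mulVec, ← mul_sub, abs_mul,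
      abs_of_nonneg (h0 i)]
    set v := ((trapGenerator x) ^ k).mulVec x
    have hm : |(∑ j, v j) / n| ≤ 2 ^ k := by
      rw [abs_div, abs_of_pos hn, div_le_iff₀ hn]
      calc |∑ j, v j| ≤ ∑ j, |v j| := Finset.abs_sum_le_sum_abs _ _
        _ ≤ ∑ _j : Fin n, (2 : ℝ) ^ k := Finset.sum_le_sum fun j _ => ih j
        _ = 2 ^ k * n := by simp [mul_comm]
    calc x i * |(∑ j, v j) / n - v i| ≤ 1 * (|(∑ j, v j) / n| + |v i|) :=
          mul_le_mul (h1 i) (abs_sub _ _) (abs_nonneg _) zero_le_one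
      _ ≤ 2 ^ (k + 1) := by rw [pow_succ]; linarith [ih i]

lemma abs_average_trapGenerator_pow_mulVec_le {x : Fin n → ℝ} (h0 : ∀ i, 0 ≤ x i)
    (h1 : ∀ i, x i ≤ 1) (k : ℕ) :
    |(∑ i, ((trapGenerator x) ^ k).mulVec x i) / n| ≤ 2 ^ k := by
  rw [abs_div, Nat.abs_cast]
  refine div_le_of_le_mul₀ (Nat.cast_nonneg _) (by positivity) ?_
  calc |∑ j, ((trapGenerator x) ^ k).mulVec x j|
      ≤ ∑ j, |((trapGenerator x) ^ k).mulVec x j| := Finset.abs_sum_le_sum_abs _ _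
    _ ≤ ∑ _j : Fin n, (2 : ℝ) ^ k :=
        Finset.sum_le_sum fun j _ => abs_trapGenerator_pow_mulVec_le h0 h1 k j
    _ = 2 ^ k * n := by simp [mul_comm]

end FiniteVolume

section InfiniteVolume

variable {x : ℕ → ℝ} {μ : ℕ → ℝ}

/-- Convergence of the moments of the empirical distribution of the rates is inherited by all the
quantities obtained from the generator: if the averages of `x ^ j * v` converge for all `j`, then
so do those of `x ^ j * Q v = x ^ (j + 1) * (average v) - x ^ (j + 1) * v`. -/
lemma exists_tendsto_average_pow_mulVec
    (hmom : ∀ k : ℕ, Tendsto (fun N : ℕ => (∑ i : Fin (N + 1), x i ^ k) / ((N + 1 : ℕ) : ℝ))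
      atTop (𝓝 (μ k))) (k j : ℕ) :
    ∃ l, Tendsto (fun N : ℕ => (∑ i : Fin (N + 1), x i ^ j *
      ((trapGenerator fun i : Fin (N + 1) => x i) ^ k).mulVec (fun i => x i) i) /
        ((N + 1 : ℕ) : ℝ)) atTop (𝓝 l) := by
  induction k generalizing j with
  | zero => exact ⟨μ (j + 1), by simpa [pow_succ] using hmom (j + 1)⟩
  | succ k ih =>
    obtain ⟨l₀, h₀⟩ := ih 0
    obtain ⟨l₁, h₁⟩ := ih (j + 1)
    refine ⟨μ (j + 1) * l₀ - l₁, (((hmom (j + 1)).mul h₀).sub h₁).congr fun N => ?_⟩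
    rw [pow_succ' (trapGenerator _) k]
    simp only [← Matrix.mulVec_mulVec, trapGenerator_mulVec, pow_zero, one_mul, mul_sub,
      Finset.sum_sub_distrib, sub_div]
    congr 1
    · rw [← mul_div_right_comm, Finset.sum_mul]
      congr 1
      exact Finset.sum_congr rfl fun i _ => by ring
    · congr 1
      exact Finset.sum_congr rfl fun i _ => by ring

theorem exists_tendsto_renewalRate (h0 : ∀ i, 0 ≤ x i) (h1 : ∀ i, x i ≤ 1)
    (hmom : ∀ k : ℕ, Tendsto (fun N : ℕ => (∑ i : Fin (N + 1), x i ^ k) / ((N + 1 : ℕ) : ℝ))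
      atTop (𝓝 (μ k))) :
    ∃ a : ℝ → ℝ, Continuous a ∧
      ∀ t, Tendsto (fun N => renewalRate (fun i : Fin (N + 1) => x i) t) atTop (𝓝 (a t)) := by
  have hex := fun k => exists_tendsto_average_pow_mulVec hmom k 0
  choose l hl using hex
  simp only [pow_zero, one_mul] at hl
  have hb : ∀ k, |l k| ≤ 2 ^ k := fun k => le_of_tendsto (hl k).abs <|
    Eventually.of_forall fun N =>
      abs_average_trapGenerator_pow_mulVec_le (fun i => h0 i) (fun i => h1 i) k
  have hsum : ∀ R : ℝ, Summable fun k : ℕ => R ^ k / (k.factorial : ℝ) * 2 ^ k := fun R =>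
    (Real.summable_pow_div_factorial (R * 2)).congr fun k => by rw [mul_pow]; ring
  have hterm : ∀ (R t b : ℝ) (k : ℕ), |t| ≤ R → |b| ≤ 2 ^ k →
      ‖t ^ k / (k.factorial : ℝ) * b‖ ≤ R ^ k / (k.factorial : ℝ) * 2 ^ k := by
    intro R t b k ht hb
    rw [Real.norm_eq_abs, abs_mul, abs_div, abs_pow, Nat.abs_cast]
    have hR : 0 ≤ R := (abs_nonneg t).trans ht
    gcongr
  refine ⟨fun t => ∑' k : ℕ, t ^ k / (k.factorial : ℝ) * l k, ?_, fun t => ?_⟩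
  · refine continuous_iff_continuousAt.2 fun t => ?_
    have : ContinuousOn (fun t : ℝ => ∑' k : ℕ, t ^ k / (k.factorial : ℝ) * l k)
        (Metric.ball 0 (|t| + 1)) := by
      refine continuousOn_tsum (fun k => by fun_prop) (hsum (|t| + 1)) fun k s hs => ?_
      exact hterm _ _ _ _ (by simpa using (Metric.mem_ball.1 hs).le) (hb k)
    exact this.continuousAt (Metric.isOpen_ball.mem_nhds (by simp))
  · refine (tendsto_tsum_of_dominated_convergence (hsum |t|)
      (fun k => (hl k).const_mul (t ^ k / (k.factorial : ℝ))) <|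
      Eventually.of_forall fun N k => ?_).congr fun N => (renewalRate_hasSum _ t).tsum_eq
    exact hterm _ _ _ _ le_rfl
      (abs_average_trapGenerator_pow_mulVec_le (fun i => h0 i) (fun i => h1 i) k)

end InfiniteVolume

/-! ### The limit of infinitely many sites -/

/-- The tail `t ↦ E [exp (-t exp (-E))]` of the waiting time at a site whose energy `E` is
exponential of parameter `α`: the rate `exp (-E)` has density `α y ^ (α - 1)` on `(0, 1)`. -/
noncomputable def trapTail (α t : ℝ) : ℝ :=
  ∫ y in 0..1, α * y ^ (α - 1) * Real.exp (-(y * t))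

section TailSeries

variable {α : ℝ}

lemma intervalIntegrable_rate_density (hα : 0 < α) (a b : ℝ) :
    IntervalIntegrable (fun y : ℝ => α * y ^ (α - 1)) volume a b :=
  (intervalIntegral.intervalIntegrable_rpow' (by linarith)).const_mul α

lemma integral_rate_density_mul_pow (hα : 0 < α) (k : ℕ) :
    ∫ y in (0 : ℝ)..1, α * y ^ (α - 1) * y ^ k = α / (α + k) := by
  have hk : (0 : ℝ) ≤ k := Nat.cast_nonneg k
  have h : ∫ y in (0 : ℝ)..1, α * y ^ (α - 1) * y ^ k =
      ∫ y in (0 : ℝ)..1, α * y ^ (α - 1 + k) := by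
    refine intervalIntegral.integral_congr_Ioo_of_le zero_le_one fun y hy => ?_
    rw [Real.rpow_add hy.1, Real.rpow_natCast, mul_assoc]
  rw [h, intervalIntegral.integral_const_mul, integral_rpow (Or.inl (by linarith)),
    Real.one_rpow, Real.zero_rpow (by linarith), show α - 1 + k + 1 = α + k by ring]
  ring

lemma trapTail_hasSum (hα : 0 < α) (t : ℝ) :
    HasSum (fun k : ℕ => (-t) ^ k / (k.factorial : ℝ) * (α / (α + k))) (trapTail α t) := by
  have h := intervalIntegral.hasSum_integral_of_dominated_convergence (μ := volume)
    (a := (0 : ℝ)) (b := 1)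
    (F := fun (k : ℕ) (y : ℝ) => (-t) ^ k / (k.factorial : ℝ) * (α * y ^ (α - 1) * y ^ k))
    (f := fun y => α * y ^ (α - 1) * Real.exp (-(y * t)))
    (fun k y => |t| ^ k / (k.factorial : ℝ) * (α * y ^ (α - 1)))
    (fun k => by fun_prop)
    (fun k => Eventually.of_forall fun y hy => by
      rw [Set.uIoc_of_le zero_le_one] at hy
      have hp : 0 ≤ α * y ^ (α - 1) := mul_nonneg hα.le (Real.rpow_nonneg hy.1.le _)
      rw [Real.norm_eq_abs, abs_mul, abs_div, abs_pow, abs_neg, Nat.abs_cast, abs_mul,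
        abs_of_nonneg hp, abs_of_nonneg (pow_nonneg hy.1.le k)]
      refine mul_le_mul_of_nonneg_left ?_ (by positivity)
      exact mul_le_of_le_one_right hp (pow_le_one₀ hy.1.le hy.2))
    (Eventually.of_forall fun y _ => (Real.summable_pow_div_factorial |t|).mul_right _)
    (by
      simp only [tsum_mul_right]
      exact (intervalIntegrable_rate_density hα 0 1).const_mul _)
    (Eventually.of_forall fun y _ => by
      have h := (NormedSpace.expSeries_div_hasSum_exp (-(y * t))).mul_left (α * y ^ (α - 1))
      rw [← Real.exp_eq_exp_ℝ] at h
      convert! h using 2 with k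
      rw [← mul_neg, mul_pow]
      ring)
  simp only [intervalIntegral.integral_const_mul, integral_rate_density_mul_pow hα] at h
  exact h

end TailSeries

section InfiniteVolume

variable {x : ℕ → ℝ} {α : ℝ}

lemma empiricalTail_nonneg {n : ℕ} (x : Fin n → ℝ) (t : ℝ) : 0 ≤ empiricalTail x t :=
  div_nonneg (Finset.sum_nonneg fun _ _ => (Real.exp_pos _).le) (Nat.cast_nonneg _)

lemma empiricalTail_le_one {n : ℕ} {x : Fin n → ℝ} (h0 : ∀ i, 0 ≤ x i) {t : ℝ} (ht : 0 ≤ t) :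
    empiricalTail x t ≤ 1 := by
  refine div_le_one_of_le₀ ?_ (Nat.cast_nonneg _)
  calc ∑ j, Real.exp (-(x j * t)) ≤ ∑ _j : Fin n, (1 : ℝ) :=
        Finset.sum_le_sum fun j _ =>
          Real.exp_le_one_iff.2 (neg_nonpos.2 (mul_nonneg (h0 j) ht))
    _ = n := by simp

lemma empiricalTail_hasSum {n : ℕ} (x : Fin n → ℝ) (t : ℝ) :
    HasSum (fun k : ℕ => (-t) ^ k / (k.factorial : ℝ) * ((∑ i, x i ^ k) / n))
      (empiricalTail x t) := by
  have h := (hasSum_sum (s := Finset.univ) fun (j : Fin n) _ =>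
    NormedSpace.expSeries_div_hasSum_exp (-(x j * t))).div_const (n : ℝ)
  simp only [← Real.exp_eq_exp_ℝ] at h
  rw [empiricalTail]
  convert! h using 2 with k
  rw [← mul_div_assoc, Finset.mul_sum]
  congr 1
  exact Finset.sum_congr rfl fun i _ => by rw [← mul_neg, mul_pow]; ring

theorem tendsto_empiricalTail (hα : 0 < α) (h0 : ∀ i, 0 ≤ x i) (h1 : ∀ i, x i ≤ 1)
    (hmom : ∀ k : ℕ, Tendsto (fun N : ℕ => (∑ i : Fin (N + 1), x i ^ k) / ((N + 1 : ℕ) : ℝ))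
      atTop (𝓝 (α / (α + k)))) {s : ℕ → ℝ} {t : ℝ} (hs : Tendsto s atTop (𝓝 t)) :
    Tendsto (fun N => empiricalTail (fun i : Fin (N + 1) => x i) (s N)) atTop
      (𝓝 (trapTail α t)) := by
  rw [← (trapTail_hasSum hα t).tsum_eq]
  have hbd : ∀ᶠ N in atTop, |s N| ≤ |t| + 1 :=
    hs.abs.eventually (eventually_le_nhds (by linarith))
  refine (tendsto_tsum_of_dominated_convergence
    (Real.summable_pow_div_factorial (|t| + 1))
    (fun k => ((hs.neg.pow k).div_const _).mul (hmom k)) ?_).congr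
      fun N => (empiricalTail_hasSum _ (s N)).tsum_eq
  filter_upwards [hbd] with N hN k
  rw [Real.norm_eq_abs, abs_mul, abs_div, abs_pow, abs_neg, Nat.abs_cast]
  have hm : |(∑ i : Fin (N + 1), x i ^ k) / ((N + 1 : ℕ) : ℝ)| ≤ 1 := by
    rw [abs_of_nonneg (div_nonneg (Finset.sum_nonneg fun (i : Fin (N + 1)) _ =>
      pow_nonneg (h0 i) k) (Nat.cast_nonneg _))]
    refine div_le_one_of_le₀ ?_ (Nat.cast_nonneg _)
    calc ∑ i : Fin (N + 1), x i ^ k ≤ ∑ _i : Fin (N + 1), (1 : ℝ) :=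
          Finset.sum_le_sum fun i _ => pow_le_one₀ (h0 i) (h1 i)
      _ = ((N + 1 : ℕ) : ℝ) := by simp
  calc |s N| ^ k / (k.factorial : ℝ) * |(∑ i : Fin (N + 1), x i ^ k) / ((N + 1 : ℕ) : ℝ)|
      ≤ (|t| + 1) ^ k / (k.factorial : ℝ) * 1 := by gcongr
    _ = _ := mul_one _

/-- Passage to the limit in the decomposition over the last time at which a new site is chosen. -/
theorem tendsto_sum_trapLaw_mul_exp (hα : 0 < α) (h0 : ∀ i, 0 ≤ x i) (h1 : ∀ i, x i ≤ 1)
    (hmom : ∀ k : ℕ, Tendsto (fun N : ℕ => (∑ i : Fin (N + 1), x i ^ k) / ((N + 1 : ℕ) : ℝ))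
      atTop (𝓝 (α / (α + k)))) {a : ℝ → ℝ}
    (ha : ∀ t, Tendsto (fun N => renewalRate (fun i : Fin (N + 1) => x i) t) atTop (𝓝 (a t)))
    (ha1 : ∀ N t, 0 ≤ t → |renewalRate (fun i : Fin (N + 1) => x i) t| ≤ 1)
    {τ : ℕ → ℝ} (hτ0 : ∀ N, 0 ≤ τ N) {u t : ℝ} (hτ : Tendsto τ atTop (𝓝 u)) (ht : 0 ≤ t) :
    Tendsto (fun N => ∑ j : Fin (N + 1), trapLaw (fun i : Fin (N + 1) => x i) t j *
        Real.exp (-(x j * τ N))) atTop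
      (𝓝 (trapTail α (t + u) + ∫ s in 0..t, trapTail α (t + u - s) * a s)) := by
  simp only [fun N => sum_trapLaw_mul_exp (fun i : Fin (N + 1) => x i) t (τ N)]
  refine (tendsto_empiricalTail hα h0 h1 hmom (hτ.const_add t)).add ?_
  refine intervalIntegral.tendsto_integral_filter_of_dominated_convergence (fun _ => 1)
    (Eventually.of_forall fun N => ?_) (Eventually.of_forall fun N =>
      Eventually.of_forall fun s hs => ?_) intervalIntegrable_const
    (Eventually.of_forall fun s _ =>
      (tendsto_empiricalTail hα h0 h1 hmom ((hτ.const_add t).sub_const s)).mul (ha s))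
  · have h2 := continuous_renewalRate fun i : Fin (N + 1) => x i
    have h3 := continuous_empiricalTail fun i : Fin (N + 1) => x i
    exact Continuous.aestronglyMeasurable (by fun_prop)
  · rw [Set.uIoc_of_le ht] at hs
    rw [norm_mul, Real.norm_eq_abs, Real.norm_eq_abs, abs_of_nonneg (empiricalTail_nonneg _ _)]
    exact mul_le_one₀ (empiricalTail_le_one (fun i => h0 i) (by linarith [hτ0 N, hs.2]))
      (abs_nonneg _) (ha1 N s hs.1.le)

end InfiniteVolume

/-! ### Asymptotics of the waiting time tail -/

section TailAsymptotics

variable {α : ℝ}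

/-- The truncated integral `α ∫_0^y z ^ (α - 1) exp (-z) dz`, which increases to `Γ (α + 1)`; it
equals `y ^ α * trapTail α y` for `y > 0`. -/
noncomputable def tailProfile (α y : ℝ) : ℝ :=
  ∫ z in 0..y, α * z ^ (α - 1) * Real.exp (-z)

lemma intervalIntegrable_tailProfile (hα : 0 < α) (a b : ℝ) :
    IntervalIntegrable (fun z : ℝ => α * z ^ (α - 1) * Real.exp (-z)) volume a b :=
  (intervalIntegrable_rate_density hα a b).mul_continuousOn (by fun_prop)

lemma continuous_tailProfile (hα : 0 < α) : Continuous (tailProfile α) :=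
  intervalIntegral.continuous_primitive (fun a b => intervalIntegrable_tailProfile hα a b) 0

lemma tailProfile_monotoneOn (hα : 0 < α) : MonotoneOn (tailProfile α) (Set.Ici 0) := by
  intro y hy z _ hyz
  rw [← sub_nonneg, tailProfile, tailProfile, intervalIntegral.integral_interval_sub_left
    (intervalIntegrable_tailProfile hα _ _) (intervalIntegrable_tailProfile hα _ _)]
  refine intervalIntegral.integral_nonneg hyz fun u hu => ?_
  have : 0 ≤ u := le_trans hy hu.1
  positivity

lemma tendsto_tailProfile (hα : 0 < α) :
    Tendsto (tailProfile α) atTop (𝓝 (Real.Gamma (α + 1))) := by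
  have h := (Real.GammaIntegral_convergent hα).const_mul α
  have h1 := intervalIntegral_tendsto_integral_Ioi 0 h tendsto_id
  rw [integral_const_mul, ← Real.Gamma_eq_integral hα, ← Real.Gamma_add_one hα.ne'] at h1
  refine h1.congr fun y => ?_
  rw [tailProfile]
  exact intervalIntegral.integral_congr fun z _ => by ring

lemma tailProfile_le (hα : 0 < α) {y : ℝ} (hy : 0 ≤ y) :
    tailProfile α y ≤ Real.Gamma (α + 1) :=
  ge_of_tendsto (tendsto_tailProfile hα) <| (eventually_ge_atTop y).mono fun _ hz =>
    tailProfile_monotoneOn hα hy (hy.trans hz) hz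

lemma tailProfile_nonneg (hα : 0 < α) {y : ℝ} (hy : 0 ≤ y) : 0 ≤ tailProfile α y := by
  have := tailProfile_monotoneOn hα (Set.mem_Ici.2 le_rfl) hy hy
  simpa [tailProfile] using this

lemma trapTail_eq_rpow_mul {t : ℝ} (ht : 0 < t) :
    trapTail α t = t ^ (-α) * tailProfile α t := by
  have h := intervalIntegral.integral_comp_mul_right
    (fun z : ℝ => α * z ^ (α - 1) * Real.exp (-z)) (a := 0) (b := 1) ht.ne'
  rw [zero_mul, one_mul, smul_eq_mul] at h
  have h2 : trapTail α t =
      t ^ (1 - α) * ∫ y in (0 : ℝ)..1, α * (y * t) ^ (α - 1) * Real.exp (-(y * t)) := by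
    rw [trapTail, ← intervalIntegral.integral_const_mul]
    refine intervalIntegral.integral_congr_Ioo_of_le zero_le_one fun y hy => ?_
    rw [Real.mul_rpow hy.1.le ht.le, show 1 - α = -(α - 1) by ring, Real.rpow_neg ht.le]
    have : t ^ (α - 1) ≠ 0 := (Real.rpow_pos_of_pos ht _).ne'
    field_simp
  rw [h2, h, tailProfile, ← mul_assoc, show -α = 1 - α + (-1) by ring, Real.rpow_add ht,
    Real.rpow_neg_one]

lemma continuous_trapTail (hα : 0 < α) : Continuous (trapTail α) := by
  refine continuous_iff_continuousAt.2 fun t => ?_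
  refine intervalIntegral.continuousAt_of_dominated_interval
    (bound := fun y => α * y ^ (α - 1) * Real.exp (|t| + 1))
    (Eventually.of_forall fun s => by fun_prop) ?_
    ((intervalIntegrable_rate_density hα 0 1).mul_const _)
    (Eventually.of_forall fun y _ => by fun_prop)
  have hb : ∀ᶠ s in 𝓝 t, |s| ≤ |t| + 1 :=
    (continuous_abs.tendsto t).eventually (eventually_le_nhds (by linarith))
  filter_upwards [hb] with s hs
  refine Eventually.of_forall fun y hy => ?_
  rw [Set.uIoc_of_le zero_le_one] at hy
  have hp : 0 ≤ α * y ^ (α - 1) := mul_nonneg hα.le (Real.rpow_nonneg hy.1.le _)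
  rw [Real.norm_eq_abs, abs_of_nonneg (mul_nonneg hp (Real.exp_pos _).le)]
  refine mul_le_mul_of_nonneg_left (Real.exp_le_exp.2 ?_) hp
  calc -(y * s) ≤ |y * s| := neg_le_abs _
    _ = y * |s| := by rw [abs_mul, abs_of_pos hy.1]
    _ ≤ 1 * |s| := by gcongr; exact hy.2
    _ ≤ |t| + 1 := by linarith

end TailAsymptotics

section Beta

variable {α : ℝ}

lemma integral_beta_one_sub (hα0 : 0 < α) (hα1 : α < 1) :
    IntervalIntegrable (fun u : ℝ => u ^ (-α) * (1 - u) ^ (α - 1)) volume 0 1 ∧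
    ∫ u in (0 : ℝ)..1, u ^ (-α) * (1 - u) ^ (α - 1) = Real.pi / Real.sin (Real.pi * α) := by
  have hcongr : ∀ u ∈ Set.uIoc (0 : ℝ) 1,
      (u : ℂ) ^ (((1 - α : ℝ) : ℂ) - 1) * (1 - (u : ℂ)) ^ ((α : ℂ) - 1) =
        ((u ^ (-α) * (1 - u) ^ (α - 1) : ℝ) : ℂ) := by
    intro u hu
    rw [Set.uIoc_of_le zero_le_one] at hu
    rw [Complex.ofReal_mul, Complex.ofReal_cpow hu.1.le, Complex.ofReal_cpow (sub_nonneg.2 hu.2)]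
    push_cast
    congr 2
    ring
  have hre0 : 0 < (((1 - α : ℝ) : ℂ)).re := by simpa using hα1
  have hre1 : 0 < ((α : ℂ)).re := by simpa using hα0
  constructor
  · have h := Complex.betaIntegral_convergent hre0 hre1
    rw [intervalIntegrable_iff] at h ⊢
    have h2 := (h.congr_fun (fun u hu => hcongr u hu) measurableSet_uIoc).re
    simpa [IntegrableOn] using h2
  · have h := beta_eq_betaIntegralReal (1 - α) α (by linarith) hα0
    rw [Complex.betaIntegral, 
      intervalIntegral.integral_congr_ae (Eventually.of_forall hcongr)] at h
    rw [intervalIntegral.integral_ofReal, Complex.ofReal_re] at h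
    rw [← h, beta, sub_add_cancel, Real.Gamma_one, div_one, mul_comm,
      Real.Gamma_mul_Gamma_one_sub]

end Beta

/-! ### Growth of the renewal function -/

section BetaConvolution

variable {α : ℝ}

/-- The convolution of `x ^ (α - 1)` with the tail `trapTail α`, after rescaling to `(0, 1)`. -/
noncomputable def betaConv (α y : ℝ) : ℝ :=
  ∫ u in 0..1, u ^ (-α) * (1 - u) ^ (α - 1) * tailProfile α (y * u)

lemma norm_betaConv_integrand_le (hα0 : 0 < α) {y u : ℝ} (hy : 0 ≤ y)
    (hu : u ∈ Set.uIoc (0 : ℝ) 1) :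
    ‖u ^ (-α) * (1 - u) ^ (α - 1) * tailProfile α (y * u)‖ ≤
      u ^ (-α) * (1 - u) ^ (α - 1) * Real.Gamma (α + 1) := by
  rw [Set.uIoc_of_le zero_le_one] at hu
  have hp : 0 ≤ u ^ (-α) * (1 - u) ^ (α - 1) :=
    mul_nonneg (Real.rpow_nonneg hu.1.le _) (Real.rpow_nonneg (sub_nonneg.2 hu.2) _)
  have hyu : 0 ≤ y * u := mul_nonneg hy hu.1.le
  rw [Real.norm_eq_abs, abs_mul, abs_of_nonneg hp, abs_of_nonneg (tailProfile_nonneg hα0 hyu)]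
  exact mul_le_mul_of_nonneg_left (tailProfile_le hα0 hyu) hp

lemma aestronglyMeasurable_betaConv_integrand (hα0 : 0 < α) (y : ℝ) {μ : Measure ℝ} :
    AEStronglyMeasurable (fun u => u ^ (-α) * (1 - u) ^ (α - 1) * tailProfile α (y * u)) μ := by
  have := (continuous_tailProfile hα0).measurable
  exact Measurable.aestronglyMeasurable (by fun_prop)

lemma continuousOn_betaConv (hα0 : 0 < α) (hα1 : α < 1) :
    ContinuousOn (betaConv α) (Set.Ici 0) := by
  intro y hy
  have hc := continuous_tailProfile hα0
  refine intervalIntegral.continuousWithinAt_of_dominated_interval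
    (bound := fun u => u ^ (-α) * (1 - u) ^ (α - 1) * Real.Gamma (α + 1))
    (Eventually.of_forall fun y => aestronglyMeasurable_betaConv_integrand hα0 y) ?_
    ((integral_beta_one_sub hα0 hα1).1.mul_const _)
    (Eventually.of_forall fun u _ => by fun_prop)
  filter_upwards [self_mem_nhdsWithin] with z hz
  exact Eventually.of_forall fun u hu => norm_betaConv_integrand_le hα0 hz hu

lemma tendsto_betaConv (hα0 : 0 < α) (hα1 : α < 1) :
    Tendsto (betaConv α) atTop
      (𝓝 (Real.pi / Real.sin (Real.pi * α) * Real.Gamma (α + 1))) := by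
  rw [← (integral_beta_one_sub hα0 hα1).2, ← intervalIntegral.integral_mul_const]
  refine intervalIntegral.tendsto_integral_filter_of_dominated_convergence
    (fun u => u ^ (-α) * (1 - u) ^ (α - 1) * Real.Gamma (α + 1))
    (Eventually.of_forall fun y => aestronglyMeasurable_betaConv_integrand hα0 y)
    ((eventually_ge_atTop 0).mono fun y hy =>
      Eventually.of_forall fun u hu => norm_betaConv_integrand_le hα0 hy hu)
    ((integral_beta_one_sub hα0 hα1).1.mul_const _)
    (Eventually.of_forall fun u hu => ?_)
  rw [Set.uIoc_of_le zero_le_one] at hu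
  exact ((tendsto_tailProfile hα0).comp (tendsto_id.atTop_mul_const hu.1)).const_mul _

lemma betaConv_le (hα0 : 0 < α) (hα1 : α < 1) {y : ℝ} (hy : 0 ≤ y) :
    betaConv α y ≤ Real.pi / Real.sin (Real.pi * α) * Real.Gamma (α + 1) := by
  rw [← (integral_beta_one_sub hα0 hα1).2, ← intervalIntegral.integral_mul_const]
  have hi := (integral_beta_one_sub hα0 hα1).1.mul_const (Real.Gamma (α + 1))
  have hi2 := hi.mono_fun (aestronglyMeasurable_betaConv_integrand hα0 y)
    ((ae_restrict_mem measurableSet_uIoc).mono fun u hu =>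
      (norm_betaConv_integrand_le hα0 hy hu).trans (Real.le_norm_self _))
  refine intervalIntegral.integral_mono_on_of_le_Ioo zero_le_one hi2 hi fun u hu => ?_
  exact (Real.le_norm_self _).trans (norm_betaConv_integrand_le hα0 hy
    (by rw [Set.uIoc_of_le zero_le_one]; exact ⟨hu.1, hu.2.le⟩))

lemma betaConv_nonneg (hα0 : 0 < α) {y : ℝ} (hy : 0 ≤ y) : 0 ≤ betaConv α y := by
  refine intervalIntegral.integral_nonneg zero_le_one fun u hu => ?_
  have := tailProfile_nonneg hα0 (mul_nonneg hy hu.1)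
  exact mul_nonneg (mul_nonneg (Real.rpow_nonneg hu.1 _)
    (Real.rpow_nonneg (sub_nonneg.2 hu.2) _)) this

lemma integral_rpow_mul_trapTail {t : ℝ} (ht : 0 ≤ t) :
    ∫ y in 0..t, (t - y) ^ (α - 1) * trapTail α y = betaConv α t := by
  rcases ht.eq_or_lt with rfl | ht
  · simp [betaConv, tailProfile]
  have h := intervalIntegral.integral_comp_mul_right
    (fun y : ℝ => (t - y) ^ (α - 1) * trapTail α y) (a := 0) (b := 1) ht.ne'
  rw [zero_mul, one_mul, smul_eq_mul, eq_inv_mul_iff_mul_eq₀ ht.ne'] at h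
  rw [← h, betaConv, ← intervalIntegral.integral_const_mul]
  refine intervalIntegral.integral_congr_Ioo_of_le zero_le_one fun u hu => ?_
  rw [trapTail_eq_rpow_mul (mul_pos hu.1 ht), show t - u * t = t * (1 - u) by ring,
    Real.mul_rpow ht.le (sub_nonneg.2 hu.2.le), Real.mul_rpow hu.1.le ht.le, mul_comm t u]
  have : t * t ^ (α - 1) * t ^ (-α) = 1 := by
    nth_rewrite 1 [← Real.rpow_one t]
    rw [← Real.rpow_add ht, ← Real.rpow_add ht]
    simp
  linear_combination (u ^ (-α) * (1 - u) ^ (α - 1) * tailProfile α (u * t)) * this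

end BetaConvolution

section Fubini

/-- Fubini's theorem on the triangle `0 < s ≤ r ≤ t`. -/
lemma integral_integral_triangle {F : ℝ → ℝ → ℝ} {t : ℝ} (ht : 0 ≤ t)
    (hF : Integrable (Function.uncurry F)
      ((volume.restrict (Set.Ioc 0 t)).prod (volume.restrict (Set.Ioc 0 t)))) :
    ∫ r in 0..t, ∫ s in 0..r, F r s = ∫ s in 0..t, ∫ r in s..t, F r s := by
  have hm : MeasurableSet {p : ℝ × ℝ | p.2 ≤ p.1} := measurableSet_le measurable_snd measurable_fst
  have h := integral_integral_swap (f := fun r s => if s ≤ r then F r s else 0)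
    (by
      have := hF.indicator hm
      refine this.congr (Eventually.of_forall fun p => ?_)
      simp [Set.indicator_apply, Function.uncurry])
  rw [intervalIntegral.integral_of_le ht, intervalIntegral.integral_of_le ht]
  have e1 : ∀ r ∈ Set.Ioc 0 t, ∫ s in 0..r, F r s =
      ∫ s in Set.Ioc 0 t, if s ≤ r then F r s else 0 := by
    intro r hr
    have : (fun s => if s ≤ r then F r s else 0) = (Set.Iic r).indicator (F r) := by
      ext s; simp [Set.indicator_apply]
    rw [intervalIntegral.integral_of_le hr.1.le, this, setIntegral_indicator measurableSet_Iic,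
      Set.Ioc_inter_Iic, min_eq_right hr.2]
  have e2 : ∀ s ∈ Set.Ioc 0 t, ∫ r in s..t, F r s =
      ∫ r in Set.Ioc 0 t, if s ≤ r then F r s else 0 := by
    intro s hs
    have : (fun r => if s ≤ r then F r s else 0) = (Set.Ici s).indicator fun r => F r s := by
      ext r; simp [Set.indicator_apply]
    rw [intervalIntegral.integral_of_le hs.2, this, setIntegral_indicator measurableSet_Ici,
      ← integral_Icc_eq_integral_Ioc]
    congr 2
    ext r
    simp only [Set.mem_Icc, Set.mem_inter_iff, Set.mem_Ioc, Set.mem_Ici]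
    exact ⟨fun h => ⟨⟨hs.1.trans_le h.1, h.2⟩, h.1⟩, fun h => ⟨h.2, h.1.2⟩⟩
  rw [setIntegral_congr_fun measurableSet_Ioc e1, setIntegral_congr_fun measurableSet_Ioc e2, h]

end Fubini

section Renewal

variable {α : ℝ} {a : ℝ → ℝ}

/-- The renewal equation convolved with `x ^ (α - 1)`. -/
lemma betaConv_add_integral (hα0 : 0 < α) (hac : Continuous a)
    (hren : ∀ t, 0 ≤ t → trapTail α t + ∫ s in 0..t, trapTail α (t - s) * a s = 1)
    {t : ℝ} (ht : 0 ≤ t) :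
    betaConv α t + ∫ s in 0..t, betaConv α (t - s) * a s = t ^ α / α := by
  have hG := continuous_trapTail hα0
  have hpow : IntervalIntegrable (fun r : ℝ => (t - r) ^ (α - 1)) volume 0 t := by
    have := (intervalIntegral.intervalIntegrable_rpow' (r := α - 1) (by linarith)
      (a := t) (b := 0)).comp_sub_left t
    simpa using this
  have hF : Integrable (Function.uncurry fun r s : ℝ =>
      (t - r) ^ (α - 1) * (trapTail α (r - s) * a s))
      ((volume.restrict (Set.Ioc 0 t)).prod (volume.restrict (Set.Ioc 0 t))) := by
    obtain ⟨C, hC⟩ := ((isCompact_Icc (a := (0 : ℝ)) (b := t)).prod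
      (isCompact_Icc (a := (0 : ℝ)) (b := t))).exists_bound_of_continuousOn
      (f := fun p : ℝ × ℝ => trapTail α (p.1 - p.2) * a p.2) (by fun_prop)
    have h1 : Integrable (fun p : ℝ × ℝ => (t - p.1) ^ (α - 1))
        ((volume.restrict (Set.Ioc 0 t)).prod (volume.restrict (Set.Ioc 0 t))) :=
      Integrable.comp_fst ((intervalIntegrable_iff_integrableOn_Ioc_of_le ht).1 hpow) _
    refine h1.mul_bdd (c := C) (Continuous.aestronglyMeasurable (by fun_prop)) ?_
    rw [Measure.prod_restrict]
    filter_upwards [ae_restrict_mem (measurableSet_Ioc.prod measurableSet_Ioc)] with p hp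
    exact hC p ⟨Set.Ioc_subset_Icc_self hp.1, Set.Ioc_subset_Icc_self hp.2⟩
  have hswap := integral_integral_triangle ht hF
  have hR : ∀ s ∈ Set.uIcc 0 t,
      ∫ r in s..t, (t - r) ^ (α - 1) * (trapTail α (r - s) * a s) = betaConv α (t - s) * a s := by
    intro s hs
    rw [Set.uIcc_of_le ht] at hs
    rw [← integral_rpow_mul_trapTail (sub_nonneg.2 hs.2), ← intervalIntegral.integral_mul_const]
    have := intervalIntegral.integral_comp_sub_right (a := s) (b := t)
      (fun y => (t - s - y) ^ (α - 1) * trapTail α y * a s) s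
    rw [sub_self] at this
    rw [← this]
    refine intervalIntegral.integral_congr fun r _ => ?_
    simp only [sub_sub_sub_cancel_right]
    ring
  have hL : ∀ r ∈ Set.uIcc 0 t,
      ∫ s in 0..r, (t - r) ^ (α - 1) * (trapTail α (r - s) * a s) =
        (t - r) ^ (α - 1) - (t - r) ^ (α - 1) * trapTail α r := by
    intro r hr
    rw [Set.uIcc_of_le ht] at hr
    rw [intervalIntegral.integral_const_mul]
    linear_combination (t - r) ^ (α - 1) * hren r hr.1
  rw [intervalIntegral.integral_congr hL, intervalIntegral.integral_congr hR,
    intervalIntegral.integral_sub hpow (hpow.mul_continuousOn hG.continuousOn),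
    integral_rpow_mul_trapTail ht] at hswap
  rw [← hswap]
  have := intervalIntegral.integral_comp_sub_left (a := 0) (b := t)
    (fun y : ℝ => y ^ (α - 1)) t
  rw [this, sub_self, sub_zero, integral_rpow (Or.inl (by linarith)), sub_add_cancel,
    Real.zero_rpow hα0.ne']
  ring

/-- The renewal function of the limiting process: the mass of `[0, t]` under the measure
`δ₀ + a(s) ds`. -/
noncomputable def renewalFunction (a : ℝ → ℝ) (t : ℝ) : ℝ := 1 + ∫ s in 0..t, a s

lemma renewalFunction_hasDerivAt (hac : Continuous a) (t : ℝ) :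
    HasDerivAt (renewalFunction a) (a t) t :=
  (hac.integral_hasStrictDerivAt 0 t).hasDerivAt.const_add 1

lemma renewalFunction_monotoneOn (hac : Continuous a) (ha0 : ∀ t, 0 ≤ t → 0 ≤ a t) :
    MonotoneOn (renewalFunction a) (Set.Ici 0) := by
  intro y hy z _ hyz
  rw [← sub_nonneg, renewalFunction, renewalFunction, add_sub_add_left_eq_sub,
    intervalIntegral.integral_interval_sub_left
    (hac.intervalIntegrable _ _) (hac.intervalIntegrable _ _)]
  exact intervalIntegral.integral_nonneg hyz fun u hu => ha0 u (le_trans hy hu.1)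

/-- The renewal equation, convolved with `x ^ (α - 1)`, determines the renewal function up to an
error which is small compared to the renewal function itself. -/
lemma renewalFunction_bounds (hα0 : 0 < α) (hα1 : α < 1) (hac : Continuous a)
    (ha0 : ∀ t, 0 ≤ t → 0 ≤ a t) (ha1 : ∀ t, 0 ≤ t → a t ≤ 1)
    (hren : ∀ t, 0 ≤ t → trapTail α t + ∫ s in 0..t, trapTail α (t - s) * a s = 1)
    {K : ℝ} (hK : K = Real.pi / Real.sin (Real.pi * α) * Real.Gamma (α + 1)) :
    (∀ t, 0 ≤ t → t ^ α / α ≤ K * renewalFunction a t) ∧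
    ∀ ε > 0, ∃ R ≥ 0, ∀ t ≥ R,
      K * renewalFunction a t ≤ t ^ α / α + ε * renewalFunction a t + K * (1 + R) := by
  have hle : ∀ y, 0 ≤ y → betaConv α y ≤ K := fun y hy => hK ▸ betaConv_le hα0 hα1 hy
  have hcont : ∀ t, 0 ≤ t → ContinuousOn (fun s => (K - betaConv α (t - s)) * a s) (Set.Icc 0 t) :=
    fun t _ => (continuousOn_const.sub ((continuousOn_betaConv hα0 hα1).comp (by fun_prop)
      fun s hs => sub_nonneg.2 hs.2)).mul hac.continuousOn
  have hint : ∀ t, 0 ≤ t → ∀ b ∈ Set.Icc 0 t, ∀ c ∈ Set.Icc 0 t,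
      IntervalIntegrable (fun s => (K - betaConv α (t - s)) * a s) volume b c :=
    fun t ht b hb c hc => ((hcont t ht).mono (Set.uIcc_subset_Icc hb hc)).intervalIntegrable
  have heq : ∀ t, 0 ≤ t → K * renewalFunction a t - t ^ α / α =
      (K - betaConv α t) + ∫ s in 0..t, (K - betaConv α (t - s)) * a s := by
    intro t ht
    have h1 : ∫ s in 0..t, betaConv α (t - s) * a s =
        ∫ s in 0..t, (K * a s - (K - betaConv α (t - s)) * a s) :=
      intervalIntegral.integral_congr fun s _ => by ring
    rw [intervalIntegral.integral_sub ((hac.intervalIntegrable _ _).const_mul K)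
      (hint t ht 0 ⟨le_rfl, ht⟩ t ⟨ht, le_rfl⟩), intervalIntegral.integral_const_mul] at h1
    have h2 := betaConv_add_integral hα0 hac hren ht
    rw [renewalFunction]
    linear_combination h2 - h1
  refine ⟨fun t ht => ?_, fun ε hε => ?_⟩
  · rw [← sub_nonneg, heq t ht]
    refine add_nonneg (sub_nonneg.2 (hle t ht)) (intervalIntegral.integral_nonneg ht fun s hs => ?_)
    exact mul_nonneg (sub_nonneg.2 (hle _ (sub_nonneg.2 hs.2))) (ha0 s hs.1)
  · have hlim := tendsto_betaConv hα0 hα1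
    rw [← hK] at hlim
    obtain ⟨R₀, hR₀⟩ := eventually_atTop.1 (hlim.eventually (eventually_ge_nhds (b := K - ε)
      (by linarith)))
    have hR : ∀ y ≥ max R₀ 0, K - betaConv α y ≤ ε := fun y hy => by
      linarith [hR₀ y ((le_max_left _ _).trans hy)]
    refine ⟨max R₀ 0, le_max_right _ _, ?_⟩
    generalize hRR : max R₀ 0 = R at hR
    have hR0 : 0 ≤ R := hRR ▸ le_max_right _ _
    intro t ht
    have ht0 : 0 ≤ t := hR0.trans ht
    have hm : t - R ∈ Set.Icc 0 t := ⟨by linarith, by linarith⟩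
    have hz : (0 : ℝ) ∈ Set.Icc 0 t := ⟨le_rfl, ht0⟩
    have htt : t ∈ Set.Icc 0 t := ⟨ht0, le_rfl⟩
    have hK0 : 0 ≤ K := (betaConv_nonneg hα0 le_rfl).trans (hle 0 le_rfl)
    have h1 : ∫ s in 0..(t - R), (K - betaConv α (t - s)) * a s ≤ ∫ s in 0..(t - R), ε * a s :=
      intervalIntegral.integral_mono_on hm.1 (hint t ht0 _ hz _ hm)
        ((hac.intervalIntegrable _ _).const_mul ε) fun s hs =>
          mul_le_mul_of_nonneg_right (hR _ (by linarith [hs.2])) (ha0 s hs.1)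
    -- the window `[t - R, t]` has bounded renewal mass because `a ≤ 1`
    have h2 : ∫ s in (t - R)..t, (K - betaConv α (t - s)) * a s ≤ ∫ _s in (t - R)..t, K := by
      refine intervalIntegral.integral_mono_on hm.2 (hint t ht0 _ hm _ htt)
        intervalIntegrable_const fun s hs => ?_
      have hs0 : 0 ≤ s := hm.1.trans hs.1
      have hb := betaConv_nonneg hα0 (sub_nonneg.2 hs.2)
      calc (K - betaConv α (t - s)) * a s ≤ (K - betaConv α (t - s)) * 1 :=
            mul_le_mul_of_nonneg_left (ha1 s hs0) (sub_nonneg.2 (hle _ (sub_nonneg.2 hs.2)))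
        _ ≤ K := by linarith
    rw [intervalIntegral.integral_const, smul_eq_mul] at h2
    rw [intervalIntegral.integral_const_mul] at h1
    have h3 := renewalFunction_monotoneOn hac ha0 hm.1 ht0 hm.2
    have h4 : renewalFunction a (t - R) = 1 + ∫ s in 0..(t - R), a s := rfl
    have h5 := intervalIntegral.integral_add_adjacent_intervals (hint t ht0 _ hz _ hm)
      (hint t ht0 _ hm _ htt)
    have h6 := heq t ht0
    have h7 := betaConv_nonneg hα0 ht0
    have h8 : ε * ∫ s in 0..(t - R), a s ≤ ε * renewalFunction a t :=
      mul_le_mul_of_nonneg_left (by linarith) hε.le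
    linarith

/-- The renewal function grows like `t ^ α`. -/
theorem tendsto_renewalFunction (hα0 : 0 < α) (hα1 : α < 1) (hac : Continuous a)
    (ha0 : ∀ t, 0 ≤ t → 0 ≤ a t) (ha1 : ∀ t, 0 ≤ t → a t ≤ 1)
    (hren : ∀ t, 0 ≤ t → trapTail α t + ∫ s in 0..t, trapTail α (t - s) * a s = 1) :
    Tendsto (fun t => renewalFunction a t * t ^ (-α)) atTop
      (𝓝 (1 / (α * (Real.pi / Real.sin (Real.pi * α) * Real.Gamma (α + 1))))) := by
  obtain ⟨hlo, hup⟩ := renewalFunction_bounds hα0 hα1 hac ha0 ha1 hren rfl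
  have hKpos : 0 < Real.pi / Real.sin (Real.pi * α) * Real.Gamma (α + 1) := by
    have : 0 < Real.sin (Real.pi * α) := Real.sin_pos_of_pos_of_lt_pi (by positivity)
      (mul_lt_of_lt_one_right Real.pi_pos hα1)
    have := Real.Gamma_pos_of_pos (s := α + 1) (by linarith)
    positivity
  generalize Real.pi / Real.sin (Real.pi * α) * Real.Gamma (α + 1) = K at *
  have hinv : ∀ t : ℝ, 0 < t → t ^ α * t ^ (-α) = 1 := fun t ht => by
    rw [← Real.rpow_add ht]; simp
  refine tendsto_order.2 ⟨fun b hb => ?_, fun b hb => ?_⟩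
  · filter_upwards [eventually_gt_atTop 0] with t ht
    refine hb.trans_le ?_
    have h1 := mul_le_mul_of_nonneg_right (hlo t ht.le) (Real.rpow_nonneg ht.le (-α))
    rw [div_mul_eq_mul_div, hinv t ht] at h1
    rw [← div_div, div_le_iff₀ hKpos]
    linarith
  · have hb0 : 0 < b := lt_trans (by positivity) hb
    -- `ε` is chosen such that `1 / (α (K - ε)) < b`
    set ε : ℝ := (K - 1 / (α * b)) / 2 with hεdef
    have hbK : 1 / (α * b) < K := by
      rw [gt_iff_lt, div_lt_iff₀ (by positivity)] at hb
      rw [div_lt_iff₀ (by positivity)]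
      linarith
    have hε : 0 < ε := by rw [hεdef]; linarith
    obtain ⟨R, -, hR⟩ := hup ε hε
    have hKε : 1 / (α * b) < K - ε := by rw [hεdef]; linarith
    have hKε0 : 0 < K - ε := lt_trans (by positivity) hKε
    have hlim : Tendsto (fun t : ℝ => (1 / α + K * (1 + R) * t ^ (-α)) / (K - ε)) atTop
        (𝓝 (1 / α / (K - ε))) := by
      simpa using (((tendsto_rpow_neg_atTop hα0).const_mul (K * (1 + R))).const_add
        (1 / α)).div_const (K - ε)
    have hlt : 1 / α / (K - ε) < b := by
      rw [div_lt_iff₀ (by positivity)] at hKε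
      rw [div_div, div_lt_iff₀ (by positivity)]
      linarith
    filter_upwards [hlim.eventually (eventually_lt_nhds hlt), eventually_gt_atTop 0,
      eventually_ge_atTop R] with t h1 ht htR
    refine lt_of_le_of_lt ?_ h1
    rw [le_div_iff₀ hKε0]
    have h2 := mul_le_mul_of_nonneg_right (hR t htR) (Real.rpow_nonneg ht.le (-α))
    have h3 := hinv t ht
    rw [add_mul, add_mul, div_mul_eq_mul_div, h3] at h2
    linarith

end Renewal

/-! ### The generalised arcsine law -/

section ArcsineLaw

variable {α θ : ℝ} {a : ℝ → ℝ}

lemma hasDerivAt_sub_rpow_neg {b s : ℝ} (h : s < b) (α : ℝ) :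
    HasDerivAt (fun s : ℝ => (b - s) ^ (-α)) (α * (b - s) ^ (-α - 1)) s := by
  have h1 : HasDerivAt (fun s : ℝ => b - s) (-1) s := (hasDerivAt_id s).const_sub b
  refine (h1.rpow_const (p := -α) (Or.inl (sub_pos.2 h).ne')).congr_deriv ?_
  ring

lemma continuousOn_sub_rpow {b c : ℝ} (h : c < b) (β : ℝ) :
    ContinuousOn (fun s : ℝ => (b - s) ^ β) (Set.Icc 0 c) :=
  (continuousOn_const.sub continuousOn_id).rpow_const fun _ hs =>
    Or.inl (sub_pos.2 (hs.2.trans_lt h)).ne'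

/-- The arcsine integral after the substitution `u = 1 - x / (1 + θ)` and an integration by
parts. -/
lemma integral_arcsine (hα0 : 0 < α) (hθ : 0 < θ) :
    ∫ u in (θ / (1 + θ))..1, u ^ (-α) * (1 - u) ^ (α - 1) =
      (θ ^ (-α) - ∫ x in 0..1, α * (1 + θ - x) ^ (-α - 1) * x ^ α) / α := by
  have h1θ : 0 < 1 + θ := by linarith
  have hsub := intervalIntegral.integral_comp_sub_div (a := 0) (b := 1)
    (fun u : ℝ => u ^ (-α) * (1 - u) ^ (α - 1)) h1θ.ne' 1
  rw [zero_div, sub_zero, smul_eq_mul, show 1 - 1 / (1 + θ) = θ / (1 + θ) by field_simp; ring]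
    at hsub
  have hscale : ∫ x in (0 : ℝ)..1, (1 + θ - x) ^ (-α) * (α * x ^ (α - 1)) =
      α * ∫ u in (θ / (1 + θ))..1, u ^ (-α) * (1 - u) ^ (α - 1) := by
    rw [← inv_mul_eq_iff_eq_mul₀ h1θ.ne'] at hsub
    rw [← hsub, ← mul_assoc, ← intervalIntegral.integral_const_mul]
    refine intervalIntegral.integral_congr_Ioo_of_le zero_le_one fun x hx => ?_
    have hpow : (1 + θ)⁻¹ * ((1 + θ) ^ (-α))⁻¹ * ((1 + θ) ^ (α - 1))⁻¹ = 1 := by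
      rw [← mul_inv, ← mul_inv, inv_eq_one]
      nth_rewrite 1 [← Real.rpow_one (1 + θ)]
      rw [← Real.rpow_add h1θ, ← Real.rpow_add h1θ, show 1 + -α + (α - 1) = 0 by ring,
        Real.rpow_zero]
    rw [sub_sub_cancel, Real.div_rpow hx.1.le h1θ.le,
      show 1 - x / (1 + θ) = (1 + θ - x) / (1 + θ) by field_simp,
      Real.div_rpow (by linarith [hx.2]) h1θ.le, div_eq_mul_inv, div_eq_mul_inv]
    linear_combination -(1 + θ - x) ^ (-α) * (α * x ^ (α - 1)) * hpow
  have hparts := intervalIntegral.integral_mul_deriv_eq_deriv_mul_of_hasDerivAt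
    (a := 0) (b := 1) (u := fun x : ℝ => (1 + θ - x) ^ (-α)) (v := fun x : ℝ => x ^ α)
    (u' := fun x => α * (1 + θ - x) ^ (-α - 1)) (v' := fun x => α * x ^ (α - 1))
    (by rw [Set.uIcc_of_le zero_le_one]; exact continuousOn_sub_rpow (by linarith) _)
    (continuousOn_id.rpow_const fun _ _ => Or.inr hα0.le)
    (fun x hx => hasDerivAt_sub_rpow_neg (by
      simp only [zero_le_one, sup_of_le_right] at hx; linarith [hx.2]) α)
    (fun x hx => by
      simp only [zero_le_one, inf_of_le_left] at hx
      simpa using Real.hasDerivAt_rpow_const (p := α) (Or.inl hx.1.ne'))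
    (ContinuousOn.intervalIntegrable (by
      rw [Set.uIcc_of_le zero_le_one]
      exact continuousOn_const.mul (continuousOn_sub_rpow (by linarith) _)))
    (intervalIntegrable_rate_density hα0 0 1)
  rw [hscale] at hparts
  rw [eq_div_iff hα0.ne', mul_comm, hparts, add_sub_cancel_left, Real.zero_rpow hα0.ne',
    Real.one_rpow]
  ring

/-- The main term: the integral of `s ↦ ((1 + θ) t - s) ^ (-α)` over `[0, t]` against the renewal
measure. -/
noncomputable def renewalIntegral (α θ : ℝ) (a : ℝ → ℝ) (t : ℝ) : ℝ :=
  ((1 + θ) * t) ^ (-α) + ∫ s in 0..t, ((1 + θ) * t - s) ^ (-α) * a s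

lemma renewalIntegral_eq (hac : Continuous a) (hθ : 0 < θ) {t : ℝ} (ht : 0 < t) :
    renewalIntegral α θ a t = θ ^ (-α) * (renewalFunction a t * t ^ (-α)) -
      ∫ x in 0..1, α * (1 + θ - x) ^ (-α - 1) * (renewalFunction a (x * t) * t ^ (-α)) := by
  have hlt : t < (1 + θ) * t := by nlinarith
  have hcont : Continuous (renewalFunction a) :=
    continuous_iff_continuousAt.2 fun s => (renewalFunction_hasDerivAt hac s).continuousAt
  have hparts := intervalIntegral.integral_mul_deriv_eq_deriv_mul_of_hasDerivAt
    (a := 0) (b := t) (u := fun s : ℝ => ((1 + θ) * t - s) ^ (-α)) (v := renewalFunction a)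
    (u' := fun s => α * ((1 + θ) * t - s) ^ (-α - 1)) (v' := a)
    (by rw [Set.uIcc_of_le ht.le]; exact continuousOn_sub_rpow hlt _)
    hcont.continuousOn
    (fun x hx => hasDerivAt_sub_rpow_neg (by
      rw [max_eq_right ht.le] at hx; linarith [hx.2]) α)
    (fun x _ => renewalFunction_hasDerivAt hac x)
    (ContinuousOn.intervalIntegrable (by
      rw [Set.uIcc_of_le ht.le]
      exact continuousOn_const.mul (continuousOn_sub_rpow hlt _)))
    (hac.intervalIntegrable _ _)
  have hsub := intervalIntegral.integral_comp_mul_right (a := 0) (b := 1)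
    (fun s => α * ((1 + θ) * t - s) ^ (-α - 1) * renewalFunction a s) ht.ne'
  rw [zero_mul, one_mul, smul_eq_mul, eq_inv_mul_iff_mul_eq₀ ht.ne',
    ← intervalIntegral.integral_const_mul] at hsub
  have h0 : renewalFunction a 0 = 1 := by simp [renewalFunction]
  rw [renewalIntegral, hparts, ← hsub, h0, sub_zero, mul_one,
    show (1 + θ) * t - t = θ * t by ring, Real.mul_rpow hθ.le ht.le]
  have hcongr : ∫ x in (0 : ℝ)..1, t * (α * ((1 + θ) * t - x * t) ^ (-α - 1) *
      renewalFunction a (x * t)) = ∫ x in (0 : ℝ)..1, α * (1 + θ - x) ^ (-α - 1) *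
      (renewalFunction a (x * t) * t ^ (-α)) := by
    refine intervalIntegral.integral_congr_Ioo_of_le zero_le_one fun x hx => ?_
    rw [← sub_mul, Real.mul_rpow (by linarith [hx.2]) ht.le, Real.rpow_sub_one ht.ne' (-α)]
    field_simp
  rw [hcongr]
  ring

lemma tendsto_renewalIntegral (hα0 : 0 < α) (hθ : 0 < θ) (hac : Continuous a)
    (ha0 : ∀ t, 0 ≤ t → 0 ≤ a t) {c : ℝ}
    (hc : Tendsto (fun t => renewalFunction a t * t ^ (-α)) atTop (𝓝 c)) :
    Tendsto (renewalIntegral α θ a) atTop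
      (𝓝 (c * α * ∫ u in (θ / (1 + θ))..1, u ^ (-α) * (1 - u) ^ (α - 1))) := by
  have hcont : Continuous (renewalFunction a) :=
    continuous_iff_continuousAt.2 fun s => (renewalFunction_hasDerivAt hac s).continuousAt
  have hmono := renewalFunction_monotoneOn hac ha0
  have hpos : ∀ t, 0 ≤ t → 0 ≤ renewalFunction a t := fun t ht => by
    have := hmono (Set.mem_Ici.2 le_rfl) ht ht
    have h0 : renewalFunction a 0 = 1 := by simp [renewalFunction]
    linarith
  have hker : ContinuousOn (fun x : ℝ => α * (1 + θ - x) ^ (-α - 1)) (Set.uIcc 0 1) := by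
    rw [Set.uIcc_of_le zero_le_one]
    exact continuousOn_const.mul (continuousOn_sub_rpow (by linarith) _)
  have hbd : ∀ᶠ t in atTop, renewalFunction a t * t ^ (-α) ≤ c + 1 :=
    hc.eventually (eventually_le_nhds (by linarith))
  have hint : Tendsto (fun t => ∫ x in (0 : ℝ)..1, α * (1 + θ - x) ^ (-α - 1) *
      (renewalFunction a (x * t) * t ^ (-α))) atTop
      (𝓝 (∫ x in (0 : ℝ)..1, α * (1 + θ - x) ^ (-α - 1) * (c * x ^ α))) := by
    refine intervalIntegral.tendsto_integral_filter_of_dominated_convergence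
      (fun x => α * (1 + θ - x) ^ (-α - 1) * (c + 1))
      (Eventually.of_forall fun t => ?_) ?_
      (hker.intervalIntegrable.mul_const _) (Eventually.of_forall fun x hx => ?_)
    · have := hcont.measurable
      exact Measurable.aestronglyMeasurable (by fun_prop)
    · filter_upwards [hbd, eventually_ge_atTop 0] with t h1 ht
      refine Eventually.of_forall fun x hx => ?_
      rw [Set.uIoc_of_le zero_le_one] at hx
      have hxt : 0 ≤ x * t := mul_nonneg hx.1.le ht
      have hk : 0 ≤ α * (1 + θ - x) ^ (-α - 1) :=
        mul_nonneg hα0.le (Real.rpow_nonneg (by linarith [hx.2]) _)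
      rw [Real.norm_eq_abs, abs_of_nonneg (mul_nonneg hk (mul_nonneg (hpos _ hxt)
        (Real.rpow_nonneg ht _)))]
      refine mul_le_mul_of_nonneg_left (le_trans ?_ h1) hk
      exact mul_le_mul_of_nonneg_right (hmono hxt ht (mul_le_of_le_one_left ht hx.2))
        (Real.rpow_nonneg ht _)
    · rw [Set.uIoc_of_le zero_le_one] at hx
      have h1 := (hc.comp (tendsto_id.const_mul_atTop hx.1)).mul_const (x ^ α)
      refine (h1.congr' ?_).const_mul _
      filter_upwards [eventually_gt_atTop 0] with t ht
      have : x ^ (-α) * x ^ α = 1 := by rw [← Real.rpow_add hx.1]; simp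
      simp only [Function.comp_apply, id]
      rw [Real.mul_rpow hx.1.le ht.le]
      linear_combination renewalFunction a (x * t) * t ^ (-α) * this
  have h := (hc.const_mul (θ ^ (-α))).sub hint
  refine Tendsto.congr' ((eventually_gt_atTop 0).mono fun t ht =>
    (renewalIntegral_eq hac hθ ht).symm) ?_
  convert! h using 2
  rw [integral_arcsine hα0 hθ, mul_assoc, mul_div_cancel₀ _ hα0.ne', mul_sub, mul_comm c]
  rw [← intervalIntegral.integral_const_mul]
  congr 1
  exact intervalIntegral.integral_congr fun x _ => by ring

/-- The **Dynkin-Lamperti theorem** for the renewal process with waiting time tail `trapTail α` and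
renewal density `a`: the probability of no renewal in `[t, (1 + θ) t]` converges to the generalised
arcsine law. -/
theorem tendsto_no_renewal (hα0 : 0 < α) (hα1 : α < 1) (hθ : 0 < θ) (hac : Continuous a)
    (ha0 : ∀ t, 0 ≤ t → 0 ≤ a t) (ha1 : ∀ t, 0 ≤ t → a t ≤ 1)
    (hren : ∀ t, 0 ≤ t → trapTail α t + ∫ s in 0..t, trapTail α (t - s) * a s = 1) :
    Tendsto (fun t => trapTail α (t + θ * t) + ∫ s in 0..t, trapTail α (t + θ * t - s) * a s)
      atTop (𝓝 (Real.sin (Real.pi * α) / Real.pi *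
        ∫ u in (θ / (1 + θ))..1, u ^ (-α) * (1 - u) ^ (α - 1))) := by
  have hI := tendsto_renewalIntegral hα0 hθ hac ha0
    (tendsto_renewalFunction hα0 hα1 hac ha0 ha1 hren)
  have hΓ : 0 < Real.Gamma (α + 1) := Real.Gamma_pos_of_pos (by linarith)
  have hprof : Tendsto (fun t => tailProfile α (θ * t)) atTop (𝓝 (Real.Gamma (α + 1))) :=
    (tendsto_tailProfile hα0).comp (tendsto_id.const_mul_atTop hθ)
  have hsin : 0 < Real.sin (Real.pi * α) := Real.sin_pos_of_pos_of_lt_pi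
    (mul_pos Real.pi_pos hα0) (mul_lt_of_lt_one_right Real.pi_pos hα1)
  have hconst : ∀ J : ℝ, Real.Gamma (α + 1) *
      (1 / (α * (Real.pi / Real.sin (Real.pi * α) * Real.Gamma (α + 1))) * α * J) =
      Real.sin (Real.pi * α) / Real.pi * J := fun J => by
    have := Real.pi_pos
    field_simp
  have hup := hI.const_mul (Real.Gamma (α + 1))
  have hlow := hprof.mul hI
  rw [hconst] at hup hlow
  have hlt : ∀ t : ℝ, 0 < t → t < (1 + θ) * t := fun t ht => by nlinarith
  -- on `[0, t]` the tail is evaluated at times beyond `θ t`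
  have htail : ∀ t : ℝ, 0 < t → ∀ s ∈ Set.Icc 0 t,
      tailProfile α (θ * t) * ((1 + θ) * t - s) ^ (-α) ≤ trapTail α (t + θ * t - s) ∧
      trapTail α (t + θ * t - s) ≤ Real.Gamma (α + 1) * ((1 + θ) * t - s) ^ (-α) := by
    intro t ht s hs
    have h1 : 0 < θ * t := mul_pos hθ ht
    have h2 : θ * t ≤ t + θ * t - s := by linarith [hs.2]
    have h3 : 0 ≤ (t + θ * t - s) ^ (-α) := Real.rpow_nonneg (by linarith) _
    rw [trapTail_eq_rpow_mul (h1.trans_le h2), show (1 + θ) * t - s = t + θ * t - s by ring,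
      mul_comm (_ ^ (-α))]
    exact ⟨mul_le_mul_of_nonneg_right
        (tailProfile_monotoneOn hα0 h1.le (h1.le.trans h2) h2) h3,
      mul_le_mul_of_nonneg_right (tailProfile_le hα0 (h1.le.trans h2)) h3⟩
  have hi1 : ∀ t : ℝ, 0 < t →
      IntervalIntegrable (fun s => ((1 + θ) * t - s) ^ (-α) * a s) volume 0 t := fun t ht =>
    ContinuousOn.intervalIntegrable (by
      rw [Set.uIcc_of_le ht.le]
      exact (continuousOn_sub_rpow (hlt t ht) _).mul hac.continuousOn)
  have hG := continuous_trapTail hα0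
  have hi2 : ∀ t : ℝ, IntervalIntegrable (fun s => trapTail α (t + θ * t - s) * a s) volume 0 t :=
    fun t => Continuous.intervalIntegrable (by fun_prop) _ _
  refine tendsto_of_tendsto_of_tendsto_of_le_of_le' hlow hup ?_ ?_
  · filter_upwards [eventually_gt_atTop 0] with t ht
    have h0 := (htail t ht 0 ⟨le_rfl, ht.le⟩).1
    rw [sub_zero, sub_zero] at h0
    rw [renewalIntegral, mul_add, ← intervalIntegral.integral_const_mul]
    refine add_le_add h0 (intervalIntegral.integral_mono_on ht.le ((hi1 t ht).const_mul _) (hi2 t)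
      fun s hs => ?_)
    rw [← mul_assoc]
    exact mul_le_mul_of_nonneg_right (htail t ht s hs).1 (ha0 s hs.1)
  · filter_upwards [eventually_gt_atTop 0] with t ht
    have h0 := (htail t ht 0 ⟨le_rfl, ht.le⟩).2
    rw [sub_zero, sub_zero] at h0
    rw [renewalIntegral, mul_add, ← intervalIntegral.integral_const_mul]
    refine add_le_add h0 (intervalIntegral.integral_mono_on ht.le (hi2 t) ((hi1 t ht).const_mul _)
      fun s hs => ?_)
    rw [← mul_assoc]
    exact mul_le_mul_of_nonneg_right (htail t ht s hs).2 (ha0 s hs.1)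

end ArcsineLaw

/-! ### The random landscape and the convergence of the correlation function -/

section Landscape

variable {α : ℝ}

lemma measurable_gammaPDF (a r : ℝ) : Measurable (gammaPDF a r) :=
  (measurable_gammaPDFReal a r).ennreal_ofReal

lemma ae_nonneg_expMeasure (α : ℝ) : ∀ᵐ y ∂(expMeasure α), 0 ≤ y := by
  rw [expMeasure, gammaMeasure, ae_withDensity_iff (measurable_gammaPDF 1 α)]
  refine Eventually.of_forall fun y hy => ?_
  by_contra h
  exact hy (gammaPDF_of_neg (not_le.1 h))

lemma integral_exp_neg_pow_expMeasure (hα : 0 < α) (k : ℕ) :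
    ∫ y, Real.exp (-y) ^ k ∂(expMeasure α) = α / (α + k) := by
  have hαk : 0 < α + k := by positivity
  rw [expMeasure, gammaMeasure, integral_withDensity_eq_integral_toReal_smul
    (measurable_gammaPDF 1 α) (Eventually.of_forall fun y => by simp [gammaPDF])]
  have h : (fun y => (gammaPDF 1 α y).toReal • Real.exp (-y) ^ k) =
      (Set.Ici 0).indicator fun y => α * Real.exp (-(α + k) * y) := by
    ext y
    rcases lt_or_ge y 0 with hy | hy
    · rw [gammaPDF_of_neg hy, Set.indicator_of_notMem (by simpa using hy)]
      simp
    · rw [gammaPDF_of_nonneg hy, Set.indicator_of_mem (Set.mem_Ici.2 hy),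
        ENNReal.toReal_ofReal (by positivity), ← Real.exp_nat_mul]
      simp only [Real.rpow_one, Real.Gamma_one, div_one, sub_self, Real.rpow_zero, mul_one,
        smul_eq_mul, mul_assoc, ← Real.exp_add]
      ring_nf
  rw [h, integral_indicator measurableSet_Ici, integral_Ici_eq_integral_Ioi, integral_const_mul,
    integral_exp_mul_Ioi (by linarith)]
  simp only [mul_zero, Real.exp_zero]
  field_simp

/-- The law of large numbers for the moments of the rates `exp (-E i)`. -/
lemma ae_tendsto_moments (hα : 0 < α) {Ω : Type*} [MeasurableSpace Ω] {P : Measure Ω}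
    {E : ℕ → Ω → ℝ} (hlaw : ∀ i, HasLaw (E i) (expMeasure α) P) (hindep : iIndepFun E P) :
    ∀ᵐ ω ∂P, ∀ k : ℕ, Tendsto
      (fun N : ℕ => (∑ i : Fin (N + 1), Real.exp (-E i ω) ^ k) / ((N + 1 : ℕ) : ℝ))
      atTop (𝓝 (α / (α + k))) := by
  have := isProbabilityMeasure_expMeasure hα
  have : IsProbabilityMeasure P := (hlaw 0).isProbabilityMeasure
  rw [ae_all_iff]
  intro k
  have hf : Measurable fun y : ℝ => Real.exp (-y) ^ k := by fun_prop
  have hint : Integrable (fun ω => Real.exp (-E 0 ω) ^ k) P := by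
    refine Integrable.of_bound
      (hf.comp_aemeasurable (hlaw 0).aemeasurable).aestronglyMeasurable 1 ?_
    filter_upwards [((hlaw 0).ae_iff (p := fun y => 0 ≤ y) (by fun_prop)).2
      (ae_nonneg_expMeasure α)] with ω hω
    rw [Real.norm_eq_abs, abs_of_nonneg (by positivity)]
    exact pow_le_one₀ (Real.exp_pos _).le (Real.exp_le_one_iff.2 (by linarith))
  have hmean : ∫ ω, Real.exp (-E 0 ω) ^ k ∂P = α / (α + k) := by
    rw [← integral_exp_neg_pow_expMeasure hα k]
    exact (hlaw 0).integral_comp hf.aestronglyMeasurable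
  have h := strong_law_ae_real (fun i ω => Real.exp (-E i ω) ^ k) hint
    (fun i j hij => (hindep.indepFun hij).comp hf hf)
    (fun i => (IdentDistrib.mk (hlaw i).aemeasurable (hlaw 0).aemeasurable
      ((hlaw i).map_eq.trans (hlaw 0).map_eq.symm)).comp hf)
  filter_upwards [h] with ω hω
  rw [hmean] at hω
  refine (hω.comp (tendsto_add_atTop_nat 1)).congr fun N => ?_
  simp only [Function.comp_apply, Finset.sum_range]

end Landscape

section TrapWalk

variable {N : ℕ} {E : ℕ → ℝ} {Ω : Type*} [MeasurableSpace Ω] {P : Measure Ω}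
  {Y : ℝ≥0 → Ω → Fin N}

lemma IsTrapWalk.measureReal_eq (hY : IsTrapWalk N E P Y) (t : ℝ≥0) (j : Fin N) :
    P.real {ω | Y t ω = j} = trapLaw (fun i : Fin N => Real.exp (-E i)) t j :=
  measureReal_marginal hY t j

lemma IsTrapWalk.sum_trapLaw (hY : IsTrapWalk N E P Y) {t : ℝ} (ht : 0 ≤ t) :
    ∑ j, trapLaw (fun i : Fin N => Real.exp (-E i)) t j = 1 := by
  lift t to ℝ≥0 using ht
  have := hY.isProbabilityMeasure
  simp only [← hY.measureReal_eq t]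
  have h := measureReal_eq_sum_fiber hY t MeasurableSet.univ
  simpa using h.symm

lemma IsTrapWalk.trapLaw_nonneg (hY : IsTrapWalk N E P Y) {t : ℝ} (ht : 0 ≤ t) (j : Fin N) :
    0 ≤ trapLaw (fun i : Fin N => Real.exp (-E i)) t j := by
  lift t to ℝ≥0 using ht
  rw [← hY.measureReal_eq t]
  exact measureReal_nonneg

lemma IsTrapWalk.renewalRate_nonneg (hY : IsTrapWalk N E P Y) {t : ℝ} (ht : 0 ≤ t) :
    0 ≤ renewalRate (fun i : Fin N => Real.exp (-E i)) t :=
  Finset.sum_nonneg fun j _ => mul_nonneg (hY.trapLaw_nonneg ht j) (Real.exp_pos _).le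

lemma IsTrapWalk.renewalRate_le_one (hY : IsTrapWalk N E P Y) (hE : ∀ i, 0 ≤ E i) {t : ℝ}
    (ht : 0 ≤ t) : renewalRate (fun i : Fin N => Real.exp (-E i)) t ≤ 1 := by
  rw [← hY.sum_trapLaw ht]
  exact Finset.sum_le_sum fun j _ => mul_le_of_le_one_right (hY.trapLaw_nonneg ht j)
    (Real.exp_le_one_iff.2 (neg_nonpos.2 (hE j)))

/-- The true exit rate from `j` is `(1 - 1 / N) exp (-E j)`, since jumps from `j` to itself are
not seen. -/
lemma IsTrapWalk.correlation_eq (hY : IsTrapWalk N E P Y) (t s : ℝ≥0) :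
    correlation P Y t s = ∑ j, trapLaw (fun i : Fin N => Real.exp (-E i)) s j *
      Real.exp (-(Real.exp (-E j) * (t * (1 - 1 / N)))) := by
  rw [correlation_eq_sum hY]
  refine Finset.sum_congr rfl fun j _ => ?_
  rw [hY.measureReal_eq]
  congr 2
  have := trapGenerator_apply (fun i : Fin N => Real.exp (-E i)) j j
  rw [trapGenerator] at this
  rw [this, if_pos rfl]
  ring

end TrapWalk

/-- For a fixed nonnegative landscape whose rates have the same asymptotic moments as independent
ones, the correlation functions converge as the number of sites tends to infinity, and the limit
ages according to the arcsine law. -/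
theorem exists_tendsto_correlation {α : ℝ} (hα0 : 0 < α) (hα1 : α < 1) {E : ℕ → ℝ}
    (hE : ∀ i, 0 ≤ E i)
    (hmom : ∀ k : ℕ, Tendsto
      (fun N : ℕ => (∑ i : Fin (N + 1), Real.exp (-E i) ^ k) / ((N + 1 : ℕ) : ℝ))
      atTop (𝓝 (α / (α + k))))
    {Ω' : ℕ → Type*} [∀ N, MeasurableSpace (Ω' N)] {P' : ∀ N, Measure (Ω' N)}
    {Y : ∀ N, ℝ≥0 → Ω' N → Fin (N + 1)} (hY : ∀ N, IsTrapWalk (N + 1) E (P' N) (Y N))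
    {θ : ℝ≥0} (hθ : 0 < θ) :
    ∃ Pilim : ℝ≥0 → ℝ,
      (∀ tw : ℝ≥0, Tendsto (fun N => correlation (P' N) (Y N) (θ * tw) tw) atTop
        (𝓝 (Pilim tw))) ∧
      Tendsto Pilim atTop (𝓝 (Real.sin (Real.pi * α) / Real.pi *
        ∫ u in ((θ : ℝ) / (1 + θ))..1, u ^ (-α) * (1 - u) ^ (α - 1))) := by
  have h0 : ∀ i, 0 ≤ Real.exp (-E i) := fun i => (Real.exp_pos _).le
  have h1 : ∀ i, Real.exp (-E i) ≤ 1 := fun i => Real.exp_le_one_iff.2 (neg_nonpos.2 (hE i))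
  obtain ⟨a, hac, ha⟩ := exists_tendsto_renewalRate (x := fun i => Real.exp (-E i)) h0 h1 hmom
  have ha0 : ∀ t, 0 ≤ t → 0 ≤ a t := fun t ht =>
    ge_of_tendsto' (ha t) fun N => (hY N).renewalRate_nonneg ht
  have ha1 : ∀ t, 0 ≤ t → a t ≤ 1 := fun t ht =>
    le_of_tendsto' (ha t) fun N => (hY N).renewalRate_le_one hE ht
  have hbd : ∀ N t, 0 ≤ t → |renewalRate (fun i : Fin (N + 1) => Real.exp (-E i)) t| ≤ 1 :=
    fun N t ht => by
      rw [abs_of_nonneg ((hY N).renewalRate_nonneg ht)]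
      exact (hY N).renewalRate_le_one hE ht
  have hlim := fun {τ : ℕ → ℝ} (hτ0 : ∀ N, 0 ≤ τ N) {u t : ℝ} (hτ : Tendsto τ atTop (𝓝 u))
    (ht : 0 ≤ t) => tendsto_sum_trapLaw_mul_exp hα0 h0 h1 hmom ha hbd hτ0 hτ ht
  have hren : ∀ t, 0 ≤ t → trapTail α t + ∫ s in 0..t, trapTail α (t - s) * a s = 1 := by
    intro t ht
    have h := hlim (τ := fun _ => 0) (fun _ => le_rfl) tendsto_const_nhds ht
    simp only [mul_zero, neg_zero, Real.exp_zero, mul_one, add_zero] at h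
    exact tendsto_nhds_unique (h.congr fun N => (hY N).sum_trapLaw ht) tendsto_const_nhds
  refine ⟨fun tw => trapTail α (tw + θ * tw) +
    ∫ s in 0..(tw : ℝ), trapTail α (tw + θ * tw - s) * a s, fun tw => ?_,
    (tendsto_no_renewal hα0 hα1 (NNReal.coe_pos.2 hθ) hac ha0 ha1 hren).comp
      (NNReal.tendsto_coe_atTop.2 tendsto_id)⟩
  have hinv : Tendsto (fun N : ℕ => 1 / ((N + 1 : ℕ) : ℝ)) atTop (𝓝 0) := by
    simpa using tendsto_one_div_add_atTop_nhds_zero_nat (𝕜 := ℝ)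
  have hτ : Tendsto (fun N : ℕ => (θ * tw : ℝ) * (1 - 1 / ((N + 1 : ℕ) : ℝ))) atTop
      (𝓝 (θ * tw)) := by
    simpa using (hinv.const_sub 1).const_mul (θ * tw : ℝ)
  refine (hlim (fun N => ?_) hτ tw.coe_nonneg).congr fun N => ?_
  · refine mul_nonneg (by positivity) (sub_nonneg.2 ?_)
    rw [div_le_one (by positivity)]
    exact_mod_cast Nat.succ_pos N
  · rw [(hY N).correlation_eq]
    push_cast
    rfl

end TrapModel


/-- The energies `E i` are independent exponential variables of parameter `α ∈ (0, 1)`. For almost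
every landscape, whatever the realisations `Y N` of the walks on `N + 1` sites in that landscape
(`N + 1`, so that there is at least one site), and for every `θ > 0`, the limit over `N` exists for
every `t_w`, and it converges, as `t_w → ∞`, to the generalised arcsine law. -/
theorem proposition2p6 (α : ℝ) (hα0 : 0 < α) (hα1 : α < 1)
    {Ω : Type*} [MeasurableSpace Ω] (P : Measure Ω) [IsProbabilityMeasure P]
    (E : ℕ → Ω → ℝ) (hlaw : ∀ i, HasLaw (E i) (expMeasure α) P) (hindep : iIndepFun E P) :
    ∀ᵐ ω ∂P, ∀ (Ω' : ℕ → Type*) [∀ N, MeasurableSpace (Ω' N)] (P' : ∀ N, Measure (Ω' N))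
      (Y : ∀ N, ℝ≥0 → Ω' N → Fin (N + 1)),
      (∀ N, TrapModel.IsTrapWalk (N + 1) (fun i => E i ω) (P' N) (Y N)) →
      ∀ θ : ℝ≥0, 0 < θ → ∃ Pilim : ℝ≥0 → ℝ,
        (∀ tw : ℝ≥0, Tendsto (fun N => TrapModel.correlation (P' N) (Y N) (θ * tw) tw)
          atTop (𝓝 (Pilim tw))) ∧
        Tendsto Pilim atTop
          (𝓝 (Real.sin (Real.pi * α) / Real.pi *
            ∫ u in ((θ : ℝ) / (1 + θ))..1, u ^ (-α) * (1 - u) ^ (α - 1))) := by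
  have hpos : ∀ᵐ ω ∂P, ∀ i, 0 ≤ E i ω := ae_all_iff.2 fun i =>
    ((hlaw i).ae_iff (p := fun y => 0 ≤ y) (by fun_prop)).2 (TrapModel.ae_nonneg_expMeasure α)
  filter_upwards [hpos, TrapModel.ae_tendsto_moments hα0 hlaw hindep] with ω hE hmom
  intro Ω' _ P' Y hY θ hθ
  exact TrapModel.exists_tendsto_correlation hα0 hα1 hE hmom hY hθ
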